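/- Let $N\ge 1$ be an integer and, for $x\in\mathbb R^N$ and $t>0$, let $$G(x,t)=(2\pi)^{-N}\int_{\mathbb R^N}e^{ix\cdot\xi}e^{-t|\xi|^4}\,d\xi$$ be the fundamental solution of $\partial_t+(-\Delta)^2$ on $\mathbb R^N$. For $\beta\in(0,N)$ put $\varphi_\beta(x)=|x|^{-\beta}$ and $$[S(t)\varphi_\beta](x)=\int_{\mathbb R^N}G(x-y,t)\,|y|^{-\beta}\,dy\qquad(x\in\mathbb R^N,\ t>0),$$ where the integral converges absolutely. Then the following hold. (i) There exist $\beta_1,\beta_2\in(0,N)$, depending only on $N$, with $\beta_1\le\beta_2$ and $$\beta_1>\begin{cases}(N+1)/2 & \text{if } N\ge 3,\\ 1/2 & \text{if } N=2,\\ 7/16 & \text{if } N=1,\end{cases}$$ such that $[S(t)\varphi_\beta](x)>0$ for all $(x,t)\in\mathbb R^N\times(0,\infty)$ whenever $\beta\in(0,\beta_1)$, and $\inf_{(x,t)\in\mathbb R^N\times(0,\infty)}[S(t)\varphi_\beta](x)<0$, i.e. $[S(t)\varphi_\beta](x)<0$ for some $(x,t)\in\mathbb R^N\times(0,\infty)$,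 whenever $\beta\in(\beta_2,N)$. (ii) Let $\beta\in(0,N)$ be such that $[S(t)\varphi_\beta](x)>0$ for all $(x,t)\in\mathbb R^N\times(0,\infty)$. Then there exists $K_*=K_*(N,\beta)>0$ such that $$[S(t)\varphi_\beta](x)\ge\frac{K_*}{|x|^\beta+t^{\beta/4}}\qquad\text{for all }(x,t)\in\mathbb R^N\times(0,\infty).$$ (iii) For every $\beta\in(0,N)$ there exists $K^*=K^*(N,\beta)>0$ such that $$\bigl|[S(t)\varphi_\beta](x)\bigr|\le\frac{K^*}{|x|^\beta+t^{\beta/4}}\qquad\text{for all }(x,t)\in\mathbb R^N\times(0,\infty).$$ -/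

import Mathlib

open MeasureTheory

noncomputable section

/-- The fundamental solution `G(x, t)` of `∂ₜ + (-Δ)²` on `ℝᴺ` (the biharmonic heat kernel),
for `t > 0`: the function with `∫ G(x, t) e^{-i x·ξ} dx = e^{-t |ξ|⁴}`, that is
`G(x, t) = (2π)^{-N} ∫ e^{i x·ξ} e^{-t |ξ|⁴} dξ`. Since `e^{-t |ξ|⁴}` is even in `ξ`, the
integral of the imaginary part vanishes and `e^{i x·ξ}` may be replaced by `cos (x·ξ)`. -/
def biharmonicHeatKernel (N : ℕ) (x : EuclideanSpace ℝ (Fin N)) (t : ℝ) : ℝ :=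
  ((2 * Real.pi) ^ N)⁻¹ *
    ∫ ξ : EuclideanSpace ℝ (Fin N), Real.cos (inner ℝ x ξ) * Real.exp (-(t * ‖ξ‖ ^ 4))

/-- `[S(t)φ](x) = ∫ G(x - y, t) φ(y) dy`. -/
def biharmonicHeatSemigroup (N : ℕ) (t : ℝ) (φ : EuclideanSpace ℝ (Fin N) → ℝ)
    (x : EuclideanSpace ℝ (Fin N)) : ℝ :=
  ∫ y : EuclideanSpace ℝ (Fin N), biharmonicHeatKernel N (x - y) t * φ y

/-- The initial datum `φ(x) = |x|^{-β}` (its value at the single point `0` is immaterial). -/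
def powerDatum (N : ℕ) (β : ℝ) (x : EuclideanSpace ℝ (Fin N)) : ℝ :=
  ‖x‖ ^ (-β)

end

/-!
By scaling everything reduces to `t = 1`. There the kernel `G` is the Fourier transform of a Schwartz
function, so it decays faster than any power, and `∫ G = 1`. Hence `|x|^β S(1)φ_β(x) - 1 = O(1 / |x|)`,
uniformly in `β` on `(0, b]` for each `b < N` (`exists_abs_norm_rpow_mul_semigroup_sub_one_le`). With
the continuity of `S(1)φ_β` this gives the upper bound and, once `S(1)φ_β` is positive, the lower
bound.

For the signs, Gaussian subordination of `|y|^{-β}` shows that `S(1)φ_β(x)` is a positive multiple of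
`∫ cos(x·ξ) e^{-|ξ|⁴} |ξ|^{β-N} dξ` (`exists_semigroup_eq_mul_profileIntegral`), which is jointly
continuous in `(β, x)` up to `β = N`, where it is a multiple of `G`. Since the symbol `e^{-|ξ|⁴}` has
vanishing second derivatives at the origin, `G` takes negative values (`exists_kernel_neg`), and so
does the integral for `β` close to `N`.

For positivity, the integral is written in polar coordinates as
`∫₀^∞ r^{β-1} e^{-r⁴} Φ(r|x|) dr`, where `Φ` is the spherical integral of the cosine. With `A = -Φ′` and
`c = (N - 1) / 2` one has `A′ = Φ - 2 c A / t`, and `w = t^c A` solves the Bessel-type equation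
`w″ + (1 - c (c + 1) / t²) w = 0`. Its primitive `W` is nonnegative
(`IsSphericalPair.primitive_nonneg`): for `q = 1 - c (c + 1) / t²` the quantity `2 W W″ - W′² + q W²` is
strictly increasing if `N ≥ 2`, which excludes a zero of `W`, and `W = Φ(0) - Φ` if `N = 1`. Two integrations by parts turn the radial integral into the
integral of `W` against minus the derivative of an explicit weight. This weight is decreasing as soon
as a quadratic polynomial in `r⁴` is nonpositive, which holds for `β` up to `(N + 1) / 2` if `N ≥ 3`,
up to `1` if `N = 2` and up to `7 / 16` if `N = 1`. Finally, positivity for all `x` is an open condition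
on `β`, by the uniform asymptotics at infinity and compactness
(`exists_forall_profileIntegral_pos`), so that it persists slightly beyond these values.
-/

open MeasureTheory Filter Topology

open scoped SchwartzMap FourierTransform

/-! ### The symbol and the kernel at time one -/

lemma exists_abs_pow_mul_gaussian_le (m : ℕ) :
    ∃ C : ℝ, ∀ x : ℝ, |x| ^ m * Real.exp (-(x ^ 2 / 2)) ≤ C := by
  refine ⟨2 ^ m * m.factorial + 1, fun x => ?_⟩
  have hx := abs_nonneg x
  rcases le_total |x| 2 with h | h
  · have h1 : |x| ^ m ≤ 2 ^ m := pow_le_pow_left₀ hx h m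
    have h2 : Real.exp (-(x ^ 2 / 2)) ≤ 1 := Real.exp_le_one_iff.2 (by nlinarith [sq_nonneg x])
    have h3 : (1 : ℝ) ≤ m.factorial := by exact_mod_cast Nat.one_le_iff_ne_zero.2 m.factorial_ne_zero
    have h4 : (0 : ℝ) < 2 ^ m := by positivity
    nlinarith [mul_le_mul h1 h2 (Real.exp_pos _).le h4.le]
  · have h1 : |x| ^ m / m.factorial ≤ Real.exp |x| := Real.pow_div_factorial_le_exp _ hx m
    have h2 : Real.exp (-(x ^ 2 / 2)) ≤ Real.exp (-|x|) := by
      apply Real.exp_le_exp.2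
      rw [← sq_abs]; nlinarith
    have h3 : (0 : ℝ) < m.factorial := by exact_mod_cast m.factorial_pos
    have h4 : (1 : ℝ) ≤ 2 ^ m := one_le_pow₀ (by norm_num)
    rw [div_le_iff₀ h3] at h1
    calc |x| ^ m * Real.exp (-(x ^ 2 / 2))
        ≤ (Real.exp |x| * m.factorial) * Real.exp (-|x|) := by gcongr
      _ = m.factorial := by rw [mul_right_comm, ← Real.exp_add]; simp
      _ ≤ _ := by nlinarith

/-- The Gaussian `x ↦ exp (-x² / 2)` on the line, as a Schwartz function. -/
noncomputable def gaussianSchwartz : 𝓢(ℝ, ℝ) where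
  toFun x := Real.exp (-(x ^ 2 / 2))
  smooth' := by fun_prop
  decay' k n := by
    have key : ∀ p : Polynomial ℤ, ∃ C : ℝ, ∀ x : ℝ,
        |x| ^ k * |Polynomial.aeval x p * Real.exp (-(x ^ 2 / 2))| ≤ C := by
      intro p
      induction p using Polynomial.induction_on' with
      | add p q hp hq =>
        obtain ⟨C, hC⟩ := hp
        obtain ⟨D, hD⟩ := hq
        refine ⟨C + D, fun x => ?_⟩
        have h := abs_add_le (Polynomial.aeval x p * Real.exp (-(x ^ 2 / 2)))
          (Polynomial.aeval x q * Real.exp (-(x ^ 2 / 2)))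
        rw [map_add, add_mul]
        have hk : 0 ≤ |x| ^ k := by positivity
        nlinarith [hC x, hD x, mul_le_mul_of_nonneg_left h hk]
      | monomial m a =>
        obtain ⟨C, hC⟩ := exists_abs_pow_mul_gaussian_le (k + m)
        refine ⟨|(a : ℝ)| * C, fun x => ?_⟩
        rw [Polynomial.aeval_monomial, abs_mul, abs_mul, abs_pow, abs_of_pos (Real.exp_pos _)]
        have h := mul_le_mul_of_nonneg_left (hC x) (abs_nonneg (a : ℝ))
        rw [pow_add] at h
        refine le_trans (le_of_eq ?_) h
        simp only [algebraMap_int_eq, eq_intCast]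
        ring
    obtain ⟨C, hC⟩ := key (Polynomial.hermite n)
    refine ⟨C, fun x => ?_⟩
    rw [norm_iteratedFDeriv_eq_norm_iteratedDeriv, iteratedDeriv_eq_iterate,
      Polynomial.deriv_gaussian_eq_hermite_mul_gaussian, Real.norm_eq_abs, Real.norm_eq_abs,
      mul_assoc, abs_mul, abs_pow, abs_neg, abs_one, one_pow, one_mul]
    exact hC x

/-- The symbol `ξ ↦ exp (-|ξ|⁴)` of the biharmonic heat semigroup at time `1`, as a Schwartz
function. -/
noncomputable def quarticSchwartz (N : ℕ) : 𝓢(EuclideanSpace ℝ (Fin N), ℂ) :=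
  SchwartzMap.postcompCLM Complex.ofRealCLM
    (SchwartzMap.compCLM ℝ (g := fun ξ : EuclideanSpace ℝ (Fin N) => √2 * ‖ξ‖ ^ 2)
      ((Function.HasTemperateGrowth.const (√2)).mul (Function.hasTemperateGrowth_norm_sq _))
      ⟨1, 1, fun ξ => by
        have h : (1 : ℝ) ≤ √2 := Real.one_le_sqrt.2 (by norm_num)
        rw [Real.norm_of_nonneg (by positivity)]
        nlinarith [sq_nonneg (‖ξ‖ - 1), sq_nonneg ‖ξ‖]⟩ gaussianSchwartz)

lemma quarticSchwartz_apply (N : ℕ) (ξ : EuclideanSpace ℝ (Fin N)) :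
    quarticSchwartz N ξ = ((Real.exp (-‖ξ‖ ^ 4) : ℝ) : ℂ) := by
  have h : quarticSchwartz N ξ = ((Real.exp (-((√2 * ‖ξ‖ ^ 2) ^ 2 / 2)) : ℝ) : ℂ) := rfl
  rw [h, mul_pow, Real.sq_sqrt (by norm_num)]
  congr 3
  ring

lemma integrable_exp_neg_norm_pow_four (N : ℕ) :
    Integrable (fun ξ : EuclideanSpace ℝ (Fin N) => Real.exp (-‖ξ‖ ^ 4)) := by
  have h := (quarticSchwartz N).integrable (μ := volume)
  refine h.norm.congr (.of_forall fun ξ => ?_)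
  simp only [quarticSchwartz_apply, Complex.norm_real, Real.norm_eq_abs, Real.abs_exp]

lemma fourier_quarticSchwartz_eq (N : ℕ) (v : EuclideanSpace ℝ (Fin N)) :
    𝓕 (quarticSchwartz N) v = (((2 * Real.pi) ^ N *
      biharmonicHeatKernel N ((2 * Real.pi) • v) 1 : ℝ) : ℂ) := by
  have hI := integrable_exp_neg_norm_pow_four N
  have hc : Integrable (fun ξ : EuclideanSpace ℝ (Fin N) =>
      Real.cos (inner ℝ ((2 * Real.pi) • v) ξ) * Real.exp (-‖ξ‖ ^ 4)) :=
    hI.bdd_mul (c := 1) (by fun_prop) (.of_forall fun ξ => by simpa using Real.abs_cos_le_one _)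
  have hs : Integrable (fun ξ : EuclideanSpace ℝ (Fin N) =>
      Real.sin (inner ℝ ((2 * Real.pi) • v) ξ) * Real.exp (-‖ξ‖ ^ 4)) :=
    hI.bdd_mul (c := 1) (by fun_prop) (.of_forall fun ξ => by simpa using Real.abs_sin_le_one _)
  have hs0 : ∫ ξ : EuclideanSpace ℝ (Fin N),
      Real.sin (inner ℝ ((2 * Real.pi) • v) ξ) * Real.exp (-‖ξ‖ ^ 4) = 0 := by
    have h := integral_neg_eq_self (fun ξ : EuclideanSpace ℝ (Fin N) =>
      Real.sin (inner ℝ ((2 * Real.pi) • v) ξ) * Real.exp (-‖ξ‖ ^ 4)) volume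
    simp only [inner_neg_right, Real.sin_neg, norm_neg, neg_mul, integral_neg] at h
    linarith
  rw [SchwartzMap.fourier_coe, Real.fourier_eq']
  have h1 : ∀ ξ : EuclideanSpace ℝ (Fin N),
      Complex.exp (((-2 * Real.pi * inner ℝ ξ v : ℝ) : ℂ) * Complex.I) • quarticSchwartz N ξ =
      ((Real.cos (inner ℝ ((2 * Real.pi) • v) ξ) * Real.exp (-‖ξ‖ ^ 4) : ℝ) : ℂ) -
      ((Real.sin (inner ℝ ((2 * Real.pi) • v) ξ) * Real.exp (-‖ξ‖ ^ 4) : ℝ) : ℂ) * Complex.I := by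
    intro ξ
    have h2 : -2 * Real.pi * inner ℝ ξ v = -(inner ℝ ((2 * Real.pi) • v) ξ) := by
      rw [real_inner_smul_left, real_inner_comm]; ring
    rw [h2, quarticSchwartz_apply, Complex.exp_mul_I, ← Complex.ofReal_cos, ← Complex.ofReal_sin,
      Real.cos_neg, Real.sin_neg, smul_eq_mul]
    push_cast
    ring
  simp_rw [h1]
  rw [integral_sub hc.ofReal (hs.ofReal.mul_const _), integral_mul_const,
    integral_complex_ofReal, integral_complex_ofReal, hs0, biharmonicHeatKernel]
  have hpi : (2 * Real.pi) ^ N ≠ 0 := by positivity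
  rw [mul_inv_cancel_left₀ hpi]
  simp

/-- The kernel at time `1` decays faster than any power. -/
lemma exists_kernel_decay (N M : ℕ) : ∃ C : ℝ, 0 < C ∧ ∀ x : EuclideanSpace ℝ (Fin N),
    (1 + ‖x‖) ^ M * |biharmonicHeatKernel N x 1| ≤ C := by
  have h := SchwartzMap.one_add_le_sup_seminorm_apply (𝕜 := ℝ) (m := (M, 0)) (k := M) (n := 0)
    le_rfl le_rfl (𝓕 (quarticSchwartz N))
  set D := 2 ^ M * ((Finset.Iic (M, 0)).sup fun m => SchwartzMap.seminorm ℝ m.1 m.2)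
    (𝓕 (quarticSchwartz N)) with hD
  refine ⟨(2 * Real.pi) ^ M * ((2 * Real.pi) ^ N)⁻¹ * |D| + 1, by positivity, fun x => ?_⟩
  have hpi : 1 ≤ 2 * Real.pi := by linarith [Real.pi_gt_three]
  have hx := h ((2 * Real.pi)⁻¹ • x)
  rw [norm_iteratedFDeriv_zero, fourier_quarticSchwartz_eq, smul_inv_smul₀ (by positivity),
    Complex.norm_real, norm_smul, Real.norm_eq_abs, Real.norm_eq_abs, abs_mul,
    abs_of_pos (by positivity : (0 : ℝ) < (2 * Real.pi) ^ N),
    abs_of_pos (by positivity : (0 : ℝ) < (2 * Real.pi)⁻¹)] at hx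
  have h1 : (1 + ‖x‖) ^ M ≤ (2 * Real.pi) ^ M * (1 + (2 * Real.pi)⁻¹ * ‖x‖) ^ M := by
    rw [← mul_pow]
    refine pow_le_pow_left₀ (by positivity) ?_ M
    rw [mul_add, mul_inv_cancel_left₀ (by positivity)]
    linarith
  calc (1 + ‖x‖) ^ M * |biharmonicHeatKernel N x 1|
      ≤ (2 * Real.pi) ^ M * (1 + (2 * Real.pi)⁻¹ * ‖x‖) ^ M * |biharmonicHeatKernel N x 1| := by
        gcongr
    _ = (2 * Real.pi) ^ M * ((2 * Real.pi) ^ N)⁻¹ * ((1 + (2 * Real.pi)⁻¹ * ‖x‖) ^ M *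
        ((2 * Real.pi) ^ N * |biharmonicHeatKernel N x 1|)) := by
        have : (2 * Real.pi) ^ N ≠ 0 := by positivity
        field_simp
    _ ≤ (2 * Real.pi) ^ M * ((2 * Real.pi) ^ N)⁻¹ * |D| := by
        gcongr
        exact hx.trans (le_abs_self _)
    _ ≤ _ := by linarith

lemma kernel_eq_re_fourier (N : ℕ) (x : EuclideanSpace ℝ (Fin N)) :
    biharmonicHeatKernel N x 1 =
      ((2 * Real.pi) ^ N)⁻¹ * (𝓕 (quarticSchwartz N) ((2 * Real.pi)⁻¹ • x)).re := by
  rw [fourier_quarticSchwartz_eq, Complex.ofReal_re, smul_inv_smul₀ (by positivity),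
    inv_mul_cancel_left₀ (by positivity)]

lemma continuous_kernel (N : ℕ) :
    Continuous fun x : EuclideanSpace ℝ (Fin N) => biharmonicHeatKernel N x 1 := by
  simp_rw [kernel_eq_re_fourier]
  have := (𝓕 (quarticSchwartz N)).continuous
  fun_prop

lemma integrable_norm_pow_mul_kernel (N k : ℕ) :
    Integrable fun x : EuclideanSpace ℝ (Fin N) => ‖x‖ ^ k * biharmonicHeatKernel N x 1 := by
  obtain ⟨C, hC, h⟩ := exists_kernel_decay N (k + (N + 1))
  refine ((integrable_one_add_norm (E := EuclideanSpace ℝ (Fin N)) (μ := volume)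
    (r := ((N + 1 : ℕ) : ℝ)) (by simp)).const_mul C).mono'
    (Continuous.aestronglyMeasurable (by have := continuous_kernel N; fun_prop))
    (.of_forall fun x => ?_)
  have h1 : 0 < 1 + ‖x‖ := by positivity
  rw [Real.rpow_neg h1.le, Real.rpow_natCast, ← div_eq_mul_inv, le_div_iff₀ (by positivity),
    norm_mul, norm_pow, norm_norm, Real.norm_eq_abs]
  refine le_trans ?_ (h x)
  rw [pow_add _ k]
  have h2 : ‖x‖ ^ k ≤ (1 + ‖x‖) ^ k := pow_le_pow_left₀ (norm_nonneg _) (by linarith) k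
  calc ‖x‖ ^ k * |biharmonicHeatKernel N x 1| * (1 + ‖x‖) ^ (N + 1)
      ≤ (1 + ‖x‖) ^ k * |biharmonicHeatKernel N x 1| * (1 + ‖x‖) ^ (N + 1) := by gcongr
    _ = _ := by ring

lemma integrable_kernel (N : ℕ) :
    Integrable fun x : EuclideanSpace ℝ (Fin N) => biharmonicHeatKernel N x 1 := by
  simpa using integrable_norm_pow_mul_kernel N 0

/-- Fourier inversion for the kernel at time `1`. -/
lemma integral_kernel_mul_cos (N : ℕ) (ξ : EuclideanSpace ℝ (Fin N)) :
    ∫ x, biharmonicHeatKernel N x 1 * Real.cos (inner ℝ x ξ) = Real.exp (-‖ξ‖ ^ 4) := by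
  have h1 : 𝓕⁻ (𝓕 (quarticSchwartz N)) ξ = quarticSchwartz N ξ := by
    rw [FourierTransform.fourierInv_fourier_eq]
  rw [SchwartzMap.fourierInv_coe, Real.fourierInv_eq', quarticSchwartz_apply] at h1
  have h2 := congrArg Complex.re h1
  have hint : Integrable fun v : EuclideanSpace ℝ (Fin N) =>
      Complex.exp (((2 * Real.pi * inner ℝ v ξ : ℝ) : ℂ) * Complex.I) •
        𝓕 (quarticSchwartz N) v := by
    refine ((𝓕 (quarticSchwartz N)).integrable (μ := volume)).bdd_mul (c := 1)
      (by fun_prop) (.of_forall fun v => ?_)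
    rw [Complex.norm_exp_ofReal_mul_I]
  have h3 := integral_re hint
  simp only [RCLike.re_eq_complex_re] at h3
  rw [← h3, Complex.ofReal_re] at h2
  rw [← h2]
  have h4 : ∀ v : EuclideanSpace ℝ (Fin N),
      (Complex.exp (((2 * Real.pi * inner ℝ v ξ : ℝ) : ℂ) * Complex.I) •
        𝓕 (quarticSchwartz N) v).re = (2 * Real.pi) ^ N *
        (biharmonicHeatKernel N ((2 * Real.pi) • v) 1 *
          Real.cos (inner ℝ ((2 * Real.pi) • v) ξ)) := by
    intro v
    rw [fourier_quarticSchwartz_eq, smul_eq_mul, Complex.re_mul_ofReal,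
      Complex.exp_ofReal_mul_I_re, real_inner_smul_left]
    ring
  simp_rw [h4]
  rw [integral_const_mul, Measure.integral_comp_smul volume
    (fun y => biharmonicHeatKernel N y 1 * Real.cos (inner ℝ y ξ)), finrank_euclideanSpace_fin,
    abs_of_pos (by positivity), smul_eq_mul, mul_inv_cancel_left₀ (by positivity)]

/-! ### Scaling -/

lemma kernel_scaling (N : ℕ) {l : ℝ} (hl : 0 < l) (x : EuclideanSpace ℝ (Fin N)) :
    biharmonicHeatKernel N (l • x) (l ^ 4) = (l ^ N)⁻¹ * biharmonicHeatKernel N x 1 := by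
  have h := Measure.integral_comp_smul (volume : Measure (EuclideanSpace ℝ (Fin N)))
    (fun ξ => Real.cos (inner ℝ x ξ) * Real.exp (-(1 * ‖ξ‖ ^ 4))) l
  rw [finrank_euclideanSpace_fin, abs_of_pos (by positivity), smul_eq_mul] at h
  unfold biharmonicHeatKernel
  rw [mul_left_comm, ← h]
  congr 2 with ξ
  rw [real_inner_smul_left, real_inner_smul_right, norm_smul, Real.norm_of_nonneg hl.le, mul_pow,
    one_mul]

lemma semigroup_scaling (N : ℕ) {l : ℝ} (hl : 0 < l) (β : ℝ) (x : EuclideanSpace ℝ (Fin N)) :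
    biharmonicHeatSemigroup N (l ^ 4) (powerDatum N β) (l • x) =
      l ^ (-β) * biharmonicHeatSemigroup N 1 (powerDatum N β) x := by
  have h := Measure.integral_comp_smul (volume : Measure (EuclideanSpace ℝ (Fin N)))
    (fun y => biharmonicHeatKernel N (l • x - y) (l ^ 4) * powerDatum N β y) l
  rw [finrank_euclideanSpace_fin, abs_of_pos (by positivity), smul_eq_mul,
    eq_inv_mul_iff_mul_eq₀ (by positivity)] at h
  unfold biharmonicHeatSemigroup
  rw [← h, ← integral_const_mul, ← integral_const_mul]
  congr 1 with y
  rw [← smul_sub, kernel_scaling N hl, powerDatum, powerDatum, norm_smul,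
    Real.norm_of_nonneg hl.le, Real.mul_rpow hl.le (norm_nonneg _)]
  have : l ^ N ≠ 0 := by positivity
  field_simp

/-! ### Absolute convergence -/

/-- A bounded integrable function stays integrable against the locally integrable weight
`|y|^(-β)`. -/
lemma integrable_mul_norm_rpow_neg {N : ℕ} (hN : 1 ≤ N) {β : ℝ} (hβ : β ∈ Set.Ioo (0 : ℝ) N)
    {f : EuclideanSpace ℝ (Fin N) → ℝ} (hf : Integrable f) {C : ℝ} (hC : ∀ y, |f y| ≤ C) :
    Integrable fun y => f y * ‖y‖ ^ (-β) := by
  have hm : AEStronglyMeasurable (fun y => f y * ‖y‖ ^ (-β)) :=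
    hf.aestronglyMeasurable.mul (by fun_prop : Measurable fun y : EuclideanSpace ℝ (Fin N) =>
      ‖y‖ ^ (-β)).aestronglyMeasurable
  rw [← integrableOn_univ, ← Set.union_compl_self (Metric.ball (0 : EuclideanSpace ℝ (Fin N)) 1)]
  refine IntegrableOn.union ?_ ?_
  · refine integrableOn_ball_of_norm_le_rpow (C := C) (α := β) (by simpa using hN)
      (by simpa using hβ.2) (.of_forall fun y => ?_) hm
    rw [norm_mul, Real.norm_eq_abs, Real.norm_of_nonneg (by positivity)]
    gcongr
    exact hC y
  · refine Integrable.mono hf.norm.integrableOn hm.restrict ?_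
    refine (ae_restrict_iff' (Metric.isOpen_ball.measurableSet.compl)).2 (.of_forall fun y hy => ?_)
    have hy1 : 1 ≤ ‖y‖ := by simpa using hy
    rw [norm_mul, norm_norm, Real.norm_of_nonneg (Real.rpow_nonneg (norm_nonneg y) _)]
    exact mul_le_of_le_one_right (norm_nonneg _)
      (Real.rpow_le_one_of_one_le_of_nonpos hy1 (by linarith [hβ.1]))

lemma exists_abs_kernel_le (N : ℕ) :
    ∃ C : ℝ, 0 < C ∧ ∀ x : EuclideanSpace ℝ (Fin N), |biharmonicHeatKernel N x 1| ≤ C := by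
  simpa using exists_kernel_decay N 0

lemma integrable_kernel_mul_powerDatum {N : ℕ} (hN : 1 ≤ N) {β : ℝ}
    (hβ : β ∈ Set.Ioo (0 : ℝ) N) (x : EuclideanSpace ℝ (Fin N)) :
    Integrable fun y => biharmonicHeatKernel N (x - y) 1 * powerDatum N β y := by
  obtain ⟨C, -, hC⟩ := exists_abs_kernel_le N
  exact integrable_mul_norm_rpow_neg hN hβ ((integrable_kernel N).comp_sub_left x)
    (fun y => hC (x - y))

lemma integrable_kernel_mul_powerDatum_scaled {N : ℕ} (hN : 1 ≤ N) {β : ℝ}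
    (hβ : β ∈ Set.Ioo (0 : ℝ) N) {l : ℝ} (hl : 0 < l) (x : EuclideanSpace ℝ (Fin N)) :
    Integrable fun y => biharmonicHeatKernel N (l • x - y) (l ^ 4) * powerDatum N β y := by
  refine (integrable_comp_smul_iff volume _ hl.ne').1 ?_
  refine ((integrable_kernel_mul_powerDatum hN hβ x).const_mul ((l ^ N)⁻¹ * l ^ (-β))).congr
    (.of_forall fun y => ?_)
  simp only
  rw [← smul_sub, kernel_scaling N hl, powerDatum, powerDatum, norm_smul,
    Real.norm_of_nonneg hl.le, Real.mul_rpow hl.le (norm_nonneg _)]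
  ring

/-! ### The solution as an oscillatory integral -/

/-- The integral `∫ cos (x·ξ) e^{-|ξ|⁴} |ξ|^{β-N} dξ`, which is a positive multiple of
`S(1) φ_β (x)` for `0 < β < N`, and of the kernel `G(x, 1)` for `β = N`. -/
noncomputable def profileIntegral (N : ℕ) (β : ℝ) (x : EuclideanSpace ℝ (Fin N)) : ℝ :=
  ∫ ξ : EuclideanSpace ℝ (Fin N),
    Real.cos (inner ℝ x ξ) * (Real.exp (-‖ξ‖ ^ 4) * ‖ξ‖ ^ (β - N))

lemma integrable_exp_mul_norm_rpow {N : ℕ} (hN : 1 ≤ N) {β : ℝ}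
    (hβ : β ∈ Set.Ioc (0 : ℝ) N) :
    Integrable fun ξ : EuclideanSpace ℝ (Fin N) => Real.exp (-‖ξ‖ ^ 4) * ‖ξ‖ ^ (β - N) := by
  rcases hβ.2.eq_or_lt with h | h
  · simpa [h] using integrable_exp_neg_norm_pow_four N
  · have := integrable_mul_norm_rpow_neg hN (β := N - β) ⟨by linarith, by linarith [hβ.1]⟩
      (integrable_exp_neg_norm_pow_four N) (C := 1) (fun y => by
        rw [Real.abs_exp]; exact Real.exp_le_one_iff.2 (by simp))
    simpa using this

/-- The Mellin-type integral `∫ σ^{-γ-1} e^{-b/σ} dσ = b^{-γ} Γ(γ)`. -/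
lemma integral_rpow_mul_exp_neg_div {γ b : ℝ} (hγ : 0 < γ) (hb : 0 < b) :
    IntegrableOn (fun σ : ℝ => σ ^ (-γ - 1) * Real.exp (-(b / σ))) (Set.Ioi 0) ∧
      ∫ σ in Set.Ioi (0 : ℝ), σ ^ (-γ - 1) * Real.exp (-(b / σ)) = b ^ (-γ) * Real.Gamma γ := by
  have h := integral_comp_rpow_Ioi (fun y : ℝ => y ^ (γ - 1) * Real.exp (-(b * y)))
    (show (-1 : ℝ) ≠ 0 by norm_num)
  have h' := integrableOn_Ioi_comp_rpow_iff (fun y : ℝ => y ^ (γ - 1) * Real.exp (-(b * y)))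
    (show (-1 : ℝ) ≠ 0 by norm_num)
  rw [Real.integral_rpow_mul_exp_neg_mul_Ioi hγ hb] at h
  have hcongr : Set.EqOn (fun σ : ℝ => (|(-1 : ℝ)| * σ ^ ((-1 : ℝ) - 1)) •
      ((σ ^ (-1 : ℝ)) ^ (γ - 1) * Real.exp (-(b * σ ^ (-1 : ℝ)))))
      (fun σ : ℝ => σ ^ (-γ - 1) * Real.exp (-(b / σ))) (Set.Ioi 0) := by
    intro σ hσ
    have hσ' : (0 : ℝ) < σ := hσ
    simp only [abs_neg, abs_one, one_mul, smul_eq_mul]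
    rw [← Real.rpow_mul hσ'.le, ← mul_assoc, ← Real.rpow_add hσ', Real.rpow_neg_one,
      div_eq_mul_inv]
    congr 2
    ring
  constructor
  · refine (integrableOn_congr_fun hcongr measurableSet_Ioi).1 (h'.2 ?_)
    by_contra hni
    have h0 := integral_undef hni
    rw [Real.integral_rpow_mul_exp_neg_mul_Ioi hγ hb] at h0
    exact (mul_pos (by positivity) (Real.Gamma_pos_of_pos hγ)).ne' h0
  · rw [← setIntegral_congr_fun measurableSet_Ioi hcongr, h, one_div, Real.inv_rpow hb.le,
      Real.rpow_neg hb.le]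

lemma integral_cos_inner_mul_gaussian (N : ℕ) {σ : ℝ} (hσ : 0 < σ)
    (ξ : EuclideanSpace ℝ (Fin N)) :
    ∫ y : EuclideanSpace ℝ (Fin N), Real.cos (inner ℝ y ξ) * Real.exp (-(σ * ‖y‖ ^ 2)) =
      (Real.pi / σ) ^ ((N : ℝ) / 2) * Real.exp (-(‖ξ‖ ^ 2 / 4 / σ)) := by
  have h := GaussianFourier.integral_cexp_neg_mul_sq_norm_add (b := (σ : ℂ)) (by simpa)
    Complex.I ξ
  have hi := GaussianFourier.integrable_cexp_neg_mul_sq_norm_add (b := (σ : ℂ)) (by simpa)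
    Complex.I ξ
  have h3 := integral_re hi
  simp only [RCLike.re_eq_complex_re] at h3
  rw [h] at h3
  have h4 : ∀ y : EuclideanSpace ℝ (Fin N),
      (Complex.exp (-(σ : ℂ) * (‖y‖ : ℂ) ^ 2 + Complex.I * ((inner ℝ ξ y : ℝ) : ℂ))).re =
      Real.cos (inner ℝ y ξ) * Real.exp (-(σ * ‖y‖ ^ 2)) := by
    intro y
    have : -(σ : ℂ) * (‖y‖ : ℂ) ^ 2 = ((-(σ * ‖y‖ ^ 2) : ℝ) : ℂ) := by push_cast; ring
    rw [Complex.exp_add, this, ← Complex.ofReal_exp, Complex.re_ofReal_mul, mul_comm Complex.I,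
      Complex.exp_ofReal_mul_I_re, real_inner_comm, mul_comm]
  simp_rw [h4] at h3
  rw [h3, finrank_euclideanSpace_fin]
  have h5 : ((Real.pi : ℂ) / σ) ^ ((N : ℂ) / 2) =
      (((Real.pi / σ) ^ ((N : ℝ) / 2) : ℝ) : ℂ) := by
    rw [Complex.ofReal_cpow (by positivity)]
    push_cast
    rfl
  have h6 : Complex.I ^ 2 * (‖ξ‖ : ℂ) ^ 2 / (4 * σ) = ((-(‖ξ‖ ^ 2 / 4 / σ) : ℝ) : ℂ) := by
    rw [Complex.I_sq]
    push_cast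
    rw [div_div, neg_one_mul, neg_div]
  rw [h5, h6, ← Complex.ofReal_exp, ← Complex.ofReal_mul, Complex.ofReal_re]

/-- The evolution of a Gaussian under the semigroup at time `1`. -/
lemma integral_kernel_mul_gaussian (N : ℕ) {σ : ℝ} (hσ : 0 < σ)
    (x : EuclideanSpace ℝ (Fin N)) :
    ∫ y : EuclideanSpace ℝ (Fin N),
        biharmonicHeatKernel N (x - y) 1 * Real.exp (-(σ * ‖y‖ ^ 2)) =
      ((2 * Real.pi) ^ N)⁻¹ * ∫ ξ : EuclideanSpace ℝ (Fin N), Real.cos (inner ℝ x ξ) *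
        (Real.exp (-‖ξ‖ ^ 4) * ((Real.pi / σ) ^ ((N : ℝ) / 2) *
          Real.exp (-(‖ξ‖ ^ 2 / 4 / σ)))) := by
  have hg : Integrable fun y : EuclideanSpace ℝ (Fin N) => Real.exp (-(σ * ‖y‖ ^ 2)) := by
    have h := GaussianFourier.integrable_cexp_neg_mul_sq_norm_add (b := (σ : ℂ)) (by simpa) 0
      (0 : EuclideanSpace ℝ (Fin N))
    refine h.norm.congr (.of_forall fun y => ?_)
    simp only [Complex.norm_exp]
    congr 1
    have : -(σ : ℂ) * (‖y‖ : ℂ) ^ 2 = ((-(σ * ‖y‖ ^ 2) : ℝ) : ℂ) := by push_cast; ring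
    rw [this, zero_mul, add_zero, Complex.ofReal_re]
  have hq := integrable_exp_neg_norm_pow_four N
  have hint : Integrable (fun p : EuclideanSpace ℝ (Fin N) × EuclideanSpace ℝ (Fin N) =>
      Real.cos (inner ℝ (x - p.1) p.2) *
        (Real.exp (-(σ * ‖p.1‖ ^ 2)) * Real.exp (-‖p.2‖ ^ 4))) (volume.prod volume) :=
    (hg.mul_prod hq).bdd_mul (c := 1) (by fun_prop)
      (.of_forall fun p => by simpa using Real.abs_cos_le_one _)
  have hsin : ∀ ξ : EuclideanSpace ℝ (Fin N), ∫ y : EuclideanSpace ℝ (Fin N),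
      Real.sin (inner ℝ y ξ) * Real.exp (-(σ * ‖y‖ ^ 2)) = 0 := by
    intro ξ
    have h := integral_neg_eq_self (fun y : EuclideanSpace ℝ (Fin N) =>
      Real.sin (inner ℝ y ξ) * Real.exp (-(σ * ‖y‖ ^ 2))) volume
    simp only [inner_neg_left, Real.sin_neg, norm_neg, neg_mul, integral_neg] at h
    linarith
  have hcosI : ∀ ξ : EuclideanSpace ℝ (Fin N), Integrable fun y : EuclideanSpace ℝ (Fin N) =>
      Real.cos (inner ℝ y ξ) * Real.exp (-(σ * ‖y‖ ^ 2)) := fun ξ =>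
    hg.bdd_mul (c := 1) (by fun_prop) (.of_forall fun ξ => by simpa using Real.abs_cos_le_one _)
  have hsinI : ∀ ξ : EuclideanSpace ℝ (Fin N), Integrable fun y : EuclideanSpace ℝ (Fin N) =>
      Real.sin (inner ℝ y ξ) * Real.exp (-(σ * ‖y‖ ^ 2)) := fun ξ =>
    hg.bdd_mul (c := 1) (by fun_prop) (.of_forall fun ξ => by simpa using Real.abs_sin_le_one _)
  calc ∫ y : EuclideanSpace ℝ (Fin N),
        biharmonicHeatKernel N (x - y) 1 * Real.exp (-(σ * ‖y‖ ^ 2))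
      = ((2 * Real.pi) ^ N)⁻¹ * ∫ y : EuclideanSpace ℝ (Fin N), ∫ ξ : EuclideanSpace ℝ (Fin N),
          Real.cos (inner ℝ (x - y) ξ) * (Real.exp (-(σ * ‖y‖ ^ 2)) * Real.exp (-‖ξ‖ ^ 4)) := by
        rw [← integral_const_mul]
        congr 1 with y
        rw [biharmonicHeatKernel, mul_assoc, ← integral_mul_const]
        congr 2 with ξ
        rw [one_mul]
        ring
    _ = ((2 * Real.pi) ^ N)⁻¹ * ∫ ξ : EuclideanSpace ℝ (Fin N), ∫ y : EuclideanSpace ℝ (Fin N),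
          Real.cos (inner ℝ (x - y) ξ) * (Real.exp (-(σ * ‖y‖ ^ 2)) * Real.exp (-‖ξ‖ ^ 4)) := by
        rw [integral_integral_swap hint]
    _ = _ := by
        congr 2 with ξ
        rw [← integral_cos_inner_mul_gaussian N hσ ξ]
        have h1 : ∀ y : EuclideanSpace ℝ (Fin N), Real.cos (inner ℝ (x - y) ξ) *
            (Real.exp (-(σ * ‖y‖ ^ 2)) * Real.exp (-‖ξ‖ ^ 4)) =
            (Real.cos (inner ℝ x ξ) * Real.exp (-‖ξ‖ ^ 4)) *
              (Real.cos (inner ℝ y ξ) * Real.exp (-(σ * ‖y‖ ^ 2))) +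
            (Real.sin (inner ℝ x ξ) * Real.exp (-‖ξ‖ ^ 4)) *
              (Real.sin (inner ℝ y ξ) * Real.exp (-(σ * ‖y‖ ^ 2))) := by
          intro y
          rw [inner_sub_left, Real.cos_sub]
          ring
        simp_rw [h1]
        rw [integral_add ((hcosI ξ).const_mul _) ((hsinI ξ).const_mul _), integral_const_mul,
          integral_const_mul, hsin]
        ring

/-- `S(1) φ_β` as an oscillatory integral: the Fourier transform of `|y|^{-β}` is a positive
multiple of `|ξ|^{β-N}`. The power `|y|^{-β}` is written as a superposition of the Gaussians
`e^{-σ|y|²}`. -/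
lemma exists_semigroup_eq_mul_profileIntegral {N : ℕ} (hN : 1 ≤ N) {β : ℝ}
    (hβ : β ∈ Set.Ioo (0 : ℝ) N) : ∃ C : ℝ, 0 < C ∧ ∀ x : EuclideanSpace ℝ (Fin N),
      biharmonicHeatSemigroup N 1 (powerDatum N β) x = C * profileIntegral N β x := by
  have hN' : Nontrivial (EuclideanSpace ℝ (Fin N)) :=
    Module.nontrivial_of_finrank_pos (R := ℝ) (by simpa using Nat.pos_of_ne_zero (by omega))
  have hne : ∀ᵐ y : EuclideanSpace ℝ (Fin N), y ≠ 0 := Measure.ae_ne volume 0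
  have hβ0 : 0 < β := hβ.1
  have hβ2 : 0 < β / 2 := by linarith
  have hγ : 0 < (N - β) / 2 := by linarith [hβ.2]
  have hΓ := Real.Gamma_pos_of_pos hβ2
  have hΓ' := Real.Gamma_pos_of_pos hγ
  set A : ℝ := (Real.pi) ^ ((N : ℝ) / 2) * ((4 : ℝ) ^ ((N - β) / 2) *
    Real.Gamma ((N - β) / 2)) with hA
  have hApos : 0 < A := by positivity
  refine ⟨(Real.Gamma (β / 2))⁻¹ * (((2 * Real.pi) ^ N)⁻¹ * A), by positivity, fun x => ?_⟩
  -- the Gamma integral in `σ`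
  have hσ1 : ∀ y : EuclideanSpace ℝ (Fin N), y ≠ 0 →
      IntegrableOn (fun σ : ℝ => σ ^ (β / 2 - 1) * Real.exp (-(‖y‖ ^ 2 * σ))) (Set.Ioi 0) ∧
      ∫ σ in Set.Ioi (0 : ℝ), σ ^ (β / 2 - 1) * Real.exp (-(‖y‖ ^ 2 * σ)) =
        ‖y‖ ^ (-β) * Real.Gamma (β / 2) := by
    intro y hy
    have hy2 : 0 < ‖y‖ ^ 2 := by positivity
    have h := Real.integral_rpow_mul_exp_neg_mul_Ioi hβ2 hy2
    have hpow : (1 / ‖y‖ ^ 2) ^ (β / 2) = ‖y‖ ^ (-β) := by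
      rw [one_div, Real.inv_rpow hy2.le, ← Real.rpow_natCast, ← Real.rpow_mul (norm_nonneg y),
        Real.rpow_neg (norm_nonneg y)]
      congr 2
      push_cast
      ring
    rw [hpow] at h
    refine ⟨?_, h⟩
    by_contra hni
    rw [integral_undef hni] at h
    have : 0 < ‖y‖ ^ (-β) * Real.Gamma (β / 2) := by positivity
    exact this.ne h
  have hint1 : Integrable (fun p : EuclideanSpace ℝ (Fin N) × ℝ =>
      biharmonicHeatKernel N (x - p.1) 1 *
        (p.2 ^ (β / 2 - 1) * Real.exp (-(‖p.1‖ ^ 2 * p.2))))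
      (volume.prod (volume.restrict (Set.Ioi 0))) := by
    have hmeas : AEStronglyMeasurable (fun p : EuclideanSpace ℝ (Fin N) × ℝ =>
      biharmonicHeatKernel N (x - p.1) 1 *
        (p.2 ^ (β / 2 - 1) * Real.exp (-(‖p.1‖ ^ 2 * p.2))))
      (volume.prod (volume.restrict (Set.Ioi 0))) := by
      have hk := (continuous_kernel N).measurable
      exact Measurable.aestronglyMeasurable (by fun_prop)
    rw [integrable_prod_iff hmeas]
    constructor
    · filter_upwards [hne] with y hy
      exact (hσ1 y hy).1.const_mul _
    · refine (((integrable_kernel_mul_powerDatum hN hβ x).norm).mul_const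
        (Real.Gamma (β / 2))).congr ?_
      filter_upwards [hne] with y hy
      rw [norm_mul, powerDatum, Real.norm_of_nonneg (Real.rpow_nonneg (norm_nonneg y) (-β)),
        mul_assoc, ← (hσ1 y hy).2, ← integral_const_mul]
      refine setIntegral_congr_fun measurableSet_Ioi fun σ hσ => ?_
      have hσ' : (0 : ℝ) < σ := hσ
      rw [norm_mul, Real.norm_of_nonneg (by positivity : 0 ≤ σ ^ (β / 2 - 1) *
        Real.exp (-(‖y‖ ^ 2 * σ)))]
  have hσ2 : ∀ ξ : EuclideanSpace ℝ (Fin N), ξ ≠ 0 →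
      IntegrableOn (fun σ : ℝ => σ ^ (β / 2 - 1) * ((Real.pi / σ) ^ ((N : ℝ) / 2) *
          Real.exp (-(‖ξ‖ ^ 2 / 4 / σ)))) (Set.Ioi 0) ∧
      ∫ σ in Set.Ioi (0 : ℝ), σ ^ (β / 2 - 1) * ((Real.pi / σ) ^ ((N : ℝ) / 2) *
          Real.exp (-(‖ξ‖ ^ 2 / 4 / σ))) = A * ‖ξ‖ ^ (β - N) := by
    intro ξ hξ
    have hb : 0 < ‖ξ‖ ^ 2 / 4 := by positivity
    obtain ⟨h1, h2⟩ := integral_rpow_mul_exp_neg_div hγ hb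
    have hcongr : Set.EqOn (fun σ : ℝ => Real.pi ^ ((N : ℝ) / 2) * (σ ^ (-((N - β) / 2) - 1) *
          Real.exp (-(‖ξ‖ ^ 2 / 4 / σ))))
        (fun σ : ℝ => σ ^ (β / 2 - 1) * ((Real.pi / σ) ^ ((N : ℝ) / 2) *
          Real.exp (-(‖ξ‖ ^ 2 / 4 / σ)))) (Set.Ioi 0) := by
      intro σ hσ
      have hσ' : (0 : ℝ) < σ := hσ
      simp only
      have : σ ^ (-((N - β) / 2) - 1) = σ ^ (β / 2 - 1) * (σ ^ ((N : ℝ) / 2))⁻¹ := by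
        rw [← Real.rpow_neg hσ'.le, ← Real.rpow_add hσ']
        congr 1
        ring
      rw [this, Real.div_rpow Real.pi_pos.le hσ'.le]
      ring
    refine ⟨(integrableOn_congr_fun hcongr measurableSet_Ioi).1 (h1.const_mul _), ?_⟩
    rw [← setIntegral_congr_fun measurableSet_Ioi hcongr, integral_const_mul, h2, hA,
      Real.div_rpow (by positivity) (by norm_num), Real.rpow_neg (by norm_num : (0 : ℝ) ≤ 4),
      div_inv_eq_mul, ← Real.rpow_natCast, ← Real.rpow_mul (norm_nonneg ξ)]
    have : ((2 : ℕ) : ℝ) * -((N - β) / 2) = β - N := by push_cast; ring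
    rw [this]
    ring
  have hint2 : Integrable (fun p : ℝ × EuclideanSpace ℝ (Fin N) =>
      (Real.cos (inner ℝ x p.2) * Real.exp (-‖p.2‖ ^ 4)) *
        (p.1 ^ (β / 2 - 1) * ((Real.pi / p.1) ^ ((N : ℝ) / 2) *
          Real.exp (-(‖p.2‖ ^ 2 / 4 / p.1)))))
      ((volume.restrict (Set.Ioi 0)).prod volume) := by
    rw [integrable_prod_iff' (Measurable.aestronglyMeasurable (by fun_prop))]
    constructor
    · filter_upwards [hne] with ξ hξ
      exact (hσ2 ξ hξ).1.const_mul _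
    · have hb := ((integrable_exp_mul_norm_rpow hN ⟨hβ.1, hβ.2.le⟩).bdd_mul (c := 1)
        (f := fun ξ => Real.cos (inner ℝ x ξ)) (by fun_prop)
        (.of_forall fun ξ => by simpa using Real.abs_cos_le_one _)).norm
      refine (hb.const_mul A).congr ?_
      filter_upwards [hne] with ξ hξ
      rw [← mul_assoc, norm_mul _ (‖ξ‖ ^ (β - N)),
        Real.norm_of_nonneg (Real.rpow_nonneg (norm_nonneg ξ) (β - N)), mul_left_comm,
        ← (hσ2 ξ hξ).2, ← integral_const_mul]
      refine setIntegral_congr_fun measurableSet_Ioi fun σ hσ => ?_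
      have hσ' : (0 : ℝ) < σ := hσ
      rw [norm_mul _ (σ ^ (β / 2 - 1) * _), Real.norm_of_nonneg (by positivity : 0 ≤
        σ ^ (β / 2 - 1) * ((Real.pi / σ) ^ ((N : ℝ) / 2) * Real.exp (-(‖ξ‖ ^ 2 / 4 / σ))))]
  have hmain : Real.Gamma (β / 2) * biharmonicHeatSemigroup N 1 (powerDatum N β) x =
      ((2 * Real.pi) ^ N)⁻¹ * (A * profileIntegral N β x) :=
    calc Real.Gamma (β / 2) * biharmonicHeatSemigroup N 1 (powerDatum N β) x
        = ∫ y : EuclideanSpace ℝ (Fin N), ∫ σ in Set.Ioi (0 : ℝ),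
            biharmonicHeatKernel N (x - y) 1 *
              (σ ^ (β / 2 - 1) * Real.exp (-(‖y‖ ^ 2 * σ))) := by
          rw [biharmonicHeatSemigroup, ← integral_const_mul]
          refine integral_congr_ae ?_
          filter_upwards [hne] with y hy
          rw [integral_const_mul, (hσ1 y hy).2, powerDatum]
          ring
      _ = ∫ σ in Set.Ioi (0 : ℝ), ∫ y : EuclideanSpace ℝ (Fin N),
            biharmonicHeatKernel N (x - y) 1 *
              (σ ^ (β / 2 - 1) * Real.exp (-(‖y‖ ^ 2 * σ))) := integral_integral_swap hint1
      _ = ((2 * Real.pi) ^ N)⁻¹ * ∫ σ in Set.Ioi (0 : ℝ), ∫ ξ : EuclideanSpace ℝ (Fin N),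
            (Real.cos (inner ℝ x ξ) * Real.exp (-‖ξ‖ ^ 4)) *
              (σ ^ (β / 2 - 1) * ((Real.pi / σ) ^ ((N : ℝ) / 2) *
                Real.exp (-(‖ξ‖ ^ 2 / 4 / σ)))) := by
          rw [← integral_const_mul]
          refine setIntegral_congr_fun measurableSet_Ioi fun σ hσ => ?_
          have h := integral_kernel_mul_gaussian N (show (0 : ℝ) < σ from hσ) x
          calc ∫ y : EuclideanSpace ℝ (Fin N), biharmonicHeatKernel N (x - y) 1 *
                (σ ^ (β / 2 - 1) * Real.exp (-(‖y‖ ^ 2 * σ)))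
              = σ ^ (β / 2 - 1) * ∫ y : EuclideanSpace ℝ (Fin N),
                  biharmonicHeatKernel N (x - y) 1 * Real.exp (-(σ * ‖y‖ ^ 2)) := by
                rw [← integral_const_mul]
                congr 1 with y
                rw [mul_comm σ]
                ring
            _ = _ := by
                rw [h, mul_left_comm, ← integral_const_mul]
                congr 2 with ξ
                ring
      _ = ((2 * Real.pi) ^ N)⁻¹ * ∫ ξ : EuclideanSpace ℝ (Fin N), ∫ σ in Set.Ioi (0 : ℝ),
            (Real.cos (inner ℝ x ξ) * Real.exp (-‖ξ‖ ^ 4)) *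
              (σ ^ (β / 2 - 1) * ((Real.pi / σ) ^ ((N : ℝ) / 2) *
                Real.exp (-(‖ξ‖ ^ 2 / 4 / σ)))) := by
          rw [integral_integral_swap hint2]
      _ = _ := by
          rw [profileIntegral, ← integral_const_mul A]
          congr 1
          refine integral_congr_ae ?_
          filter_upwards [hne] with ξ hξ
          rw [integral_const_mul, (hσ2 ξ hξ).2]
          ring
  rw [mul_assoc, eq_inv_mul_iff_mul_eq₀ hΓ.ne', hmain]
  ring

/-! ### Continuity in the exponent and in space -/

lemma continuousOn_profileIntegral {N : ℕ} (hN : 1 ≤ N) :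
    ContinuousOn (fun p : ℝ × EuclideanSpace ℝ (Fin N) => profileIntegral N p.1 p.2)
      (Set.Ioc (0 : ℝ) N ×ˢ Set.univ) := by
  have hN' : Nontrivial (EuclideanSpace ℝ (Fin N)) :=
    Module.nontrivial_of_finrank_pos (R := ℝ) (by simpa using Nat.pos_of_ne_zero (by omega))
  rintro ⟨b, x⟩ ⟨hb, -⟩
  simp only at hb
  have hev : ∀ᶠ p : ℝ × EuclideanSpace ℝ (Fin N) in
      𝓝[Set.Ioc (0 : ℝ) N ×ˢ Set.univ] (b, x), b / 2 < p.1 ∧ p.1 ≤ N := by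
    refine Filter.Eventually.and ?_ (eventually_mem_nhdsWithin.mono fun p hp => hp.1.2)
    exact nhdsWithin_le_nhds (continuous_fst.continuousAt.eventually
      (lt_mem_nhds (by simpa using hb.1)))
  have hi1 := integrable_exp_mul_norm_rpow hN (β := b / 2) ⟨by linarith [hb.1],
    by linarith [hb.1, hb.2]⟩
  refine continuousWithinAt_of_dominated (bound := fun ξ : EuclideanSpace ℝ (Fin N) =>
    Real.exp (-‖ξ‖ ^ 4) * ‖ξ‖ ^ (b / 2 - N) + Real.exp (-‖ξ‖ ^ 4)) ?_ ?_ ?_ ?_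
  · exact .of_forall fun p => Measurable.aestronglyMeasurable (by fun_prop)
  · filter_upwards [hev] with p hp
    filter_upwards [Measure.ae_ne volume (0 : EuclideanSpace ℝ (Fin N))] with ξ hξ
    have hξ0 : 0 < ‖ξ‖ := norm_pos_iff.2 hξ
    have h1 : ‖ξ‖ ^ (p.1 - N) ≤ ‖ξ‖ ^ (b / 2 - N) + 1 := by
      rcases le_total ‖ξ‖ 1 with h | h
      · have := Real.rpow_le_rpow_of_exponent_ge hξ0 h (by linarith [hp.1] : b / 2 - N ≤ p.1 - N)
        linarith
      · have := Real.rpow_le_one_of_one_le_of_nonpos h (by linarith [hp.2] : p.1 - N ≤ 0)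
        have h2 : 0 ≤ ‖ξ‖ ^ (b / 2 - N) := by positivity
        linarith
    have h3 : 0 ≤ Real.exp (-‖ξ‖ ^ 4) * ‖ξ‖ ^ (p.1 - N) := by positivity
    rw [norm_mul, Real.norm_of_nonneg h3, Real.norm_eq_abs]
    calc _ ≤ 1 * (Real.exp (-‖ξ‖ ^ 4) * ‖ξ‖ ^ (p.1 - N)) := by
          gcongr; exact Real.abs_cos_le_one _
      _ ≤ 1 * (Real.exp (-‖ξ‖ ^ 4) * (‖ξ‖ ^ (b / 2 - N) + 1)) := by gcongr
      _ = _ := by ring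
  · exact hi1.add (integrable_exp_neg_norm_pow_four N)
  · filter_upwards [Measure.ae_ne volume (0 : EuclideanSpace ℝ (Fin N))] with ξ hξ
    have hξ0 : ‖ξ‖ ≠ 0 := norm_ne_zero_iff.2 hξ
    refine ContinuousAt.continuousWithinAt ?_
    have h1 : ContinuousAt (fun p : ℝ × EuclideanSpace ℝ (Fin N) => ‖ξ‖ ^ (p.1 - N)) (b, x) :=
      ContinuousAt.rpow continuousAt_const (by fun_prop) (Or.inl hξ0)
    fun_prop

lemma continuousAt_profileIntegral {N : ℕ} (hN : 1 ≤ N) {β : ℝ} (hβ : β ∈ Set.Ioo (0 : ℝ) N)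
    (x : EuclideanSpace ℝ (Fin N)) :
    ContinuousAt (fun p : ℝ × EuclideanSpace ℝ (Fin N) => profileIntegral N p.1 p.2) (β, x) := by
  refine (continuousOn_profileIntegral hN).continuousAt ?_
  exact prod_mem_nhds (Ioc_mem_nhds hβ.1 hβ.2) univ_mem

lemma continuous_semigroup_one {N : ℕ} (hN : 1 ≤ N) {β : ℝ} (hβ : β ∈ Set.Ioo (0 : ℝ) N) :
    Continuous fun x => biharmonicHeatSemigroup N 1 (powerDatum N β) x := by
  obtain ⟨C, -, hC⟩ := exists_semigroup_eq_mul_profileIntegral hN hβ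
  simp_rw [hC]
  refine continuous_const.mul (continuous_iff_continuousAt.2 fun x => ?_)
  exact (continuousAt_profileIntegral hN hβ x).comp (f := fun y => (β, y)) (by fun_prop)

/-! ### Spatial decay and two-sided bounds at time one -/

lemma abs_rpow_sub_one_le_of_le {ρ β : ℝ} {n : ℕ} (hρ : 0 < ρ) (hβ : 0 ≤ β) (hn : β ≤ n) :
    |ρ ^ β - 1| ≤ |ρ ^ n - 1| := by
  rw [← Real.rpow_natCast]
  rcases le_total 1 ρ with h | h
  · have h1 := Real.one_le_rpow h hβ
    have h2 := Real.rpow_le_rpow_of_exponent_le h hn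
    rw [abs_of_nonneg (by linarith), abs_of_nonneg (by linarith)]
    linarith
  · have h1 := Real.rpow_le_one hρ.le h hβ
    have h2 := Real.rpow_le_rpow_of_exponent_ge hρ h hn
    rw [abs_of_nonpos (by linarith), abs_of_nonpos (by linarith)]
    linarith

lemma abs_pow_sub_one_le {ρ : ℝ} (hρ : 0 ≤ ρ) (h2 : ρ ≤ 2) (n : ℕ) :
    |ρ ^ n - 1| ≤ n * 2 ^ n * |ρ - 1| := by
  induction n with
  | zero => simp
  | succ n ih =>
    have h : ρ ^ (n + 1) - 1 = ρ * (ρ ^ n - 1) + (ρ - 1) := by ring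
    have h1 := abs_add_le (ρ * (ρ ^ n - 1)) (ρ - 1)
    rw [abs_mul, abs_of_nonneg hρ] at h1
    have h3 : (1 : ℝ) ≤ 2 ^ n := one_le_pow₀ (by norm_num)
    rw [h]
    push_cast
    rw [pow_succ]
    have h4 := abs_nonneg (ρ - 1)
    have h5 := abs_nonneg (ρ ^ n - 1)
    nlinarith [mul_le_mul h2 ih h5 (by norm_num), mul_nonneg (sub_nonneg.2 h3) h4]

/-- The solution has the spatial decay of its initial datum, uniformly in the exponent. Where
`|x - z| ≥ |x| / 2` the ratio `(|x| / |x - z|)^β` is within `O(|z| / |x|)` of `1`; the remaining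
`z` satisfy `|z| ≥ |x| / 2`, and there the decay of the kernel wins. -/
lemma exists_abs_norm_rpow_mul_semigroup_sub_one_le {N : ℕ} (hN : 1 ≤ N) {b : ℝ}
    (hb : b ∈ Set.Ioo (0 : ℝ) N) : ∃ C : ℝ, 0 < C ∧ ∀ β ∈ Set.Ioc (0 : ℝ) b,
      ∀ x : EuclideanSpace ℝ (Fin N), 1 ≤ ‖x‖ →
        |‖x‖ ^ β * biharmonicHeatSemigroup N 1 (powerDatum N β) x - 1| ≤ C / ‖x‖ := by
  have hN' : Nontrivial (EuclideanSpace ℝ (Fin N)) :=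
    Module.nontrivial_of_finrank_pos (R := ℝ) (by simpa using Nat.pos_of_ne_zero (by omega))
  obtain ⟨D, hD0, hD⟩ := exists_kernel_decay N (2 * N + 2)
  -- the dominating functions for the two regions
  set m : EuclideanSpace ℝ (Fin N) → ℝ := fun v =>
    (1 + ‖v‖) ^ (-((N + 1 : ℕ) : ℝ)) * ‖v‖ ^ (-b) with hm
  have hmI : Integrable m := by
    refine integrable_mul_norm_rpow_neg hN hb (C := 1)
      (integrable_one_add_norm (by simp)) fun y => ?_
    rw [abs_of_nonneg (by positivity)]
    exact Real.rpow_le_one_of_one_le_of_nonpos (by linarith [norm_nonneg y])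
      (by simp only [Left.neg_nonpos_iff]; positivity)
  have hkI : Integrable fun z : EuclideanSpace ℝ (Fin N) => ‖z‖ * |biharmonicHeatKernel N z 1| := by
    simpa using (integrable_norm_pow_mul_kernel N 1).norm
  set J1 := ∫ z : EuclideanSpace ℝ (Fin N), ‖z‖ * |biharmonicHeatKernel N z 1| with hJ1
  set J2 := ∫ v, m v with hJ2
  have hJ1' : 0 ≤ J1 := integral_nonneg fun z => by positivity
  have hJ2' : 0 ≤ J2 := integral_nonneg fun z => by positivity
  refine ⟨(N * 2 ^ N * 2) * J1 + D * 2 ^ (N + 1) * J2 + 1, by positivity, fun β hβ x hx => ?_⟩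
  have hβN : β ∈ Set.Ioo (0 : ℝ) N := ⟨hβ.1, hβ.2.trans_lt hb.2⟩
  have hx0 : 0 < ‖x‖ := by linarith
  have hK1 : ∫ z : EuclideanSpace ℝ (Fin N), biharmonicHeatKernel N z 1 = 1 := by
    simpa using integral_kernel_mul_cos N 0
  have hi : Integrable fun z : EuclideanSpace ℝ (Fin N) =>
      biharmonicHeatKernel N z 1 * ‖x - z‖ ^ (-β) := by
    have := (integrable_kernel_mul_powerDatum hN hβN x).comp_sub_left x
    simpa [powerDatum] using this
  have hu : biharmonicHeatSemigroup N 1 (powerDatum N β) x =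
      ∫ z : EuclideanSpace ℝ (Fin N), biharmonicHeatKernel N z 1 * ‖x - z‖ ^ (-β) := by
    rw [biharmonicHeatSemigroup, ← integral_sub_left_eq_self _ volume x]
    simp [powerDatum]
  have heq : ‖x‖ ^ β * biharmonicHeatSemigroup N 1 (powerDatum N β) x - 1 =
      ∫ z : EuclideanSpace ℝ (Fin N),
        biharmonicHeatKernel N z 1 * (‖x‖ ^ β * ‖x - z‖ ^ (-β) - 1) := by
    rw [hu, ← integral_const_mul]
    nth_rewrite 2 [← hK1]
    rw [← integral_sub (hi.const_mul _) (integrable_kernel N)]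
    congr 1 with z
    ring
  have hbound : ∀ᵐ z : EuclideanSpace ℝ (Fin N),
      ‖biharmonicHeatKernel N z 1 * (‖x‖ ^ β * ‖x - z‖ ^ (-β) - 1)‖ ≤
      (N * 2 ^ N * 2 / ‖x‖) * (‖z‖ * |biharmonicHeatKernel N z 1|) +
        (D * 2 ^ (N + 1) / ‖x‖) * m (x - z) := by
    filter_upwards [Measure.ae_ne volume x] with z hz
    have hv0 : 0 < ‖x - z‖ := norm_pos_iff.2 (sub_ne_zero.2 hz.symm)
    set ρ := ‖x‖ / ‖x - z‖ with hρ
    have hρ0 : 0 < ρ := by positivity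
    have hρβ : ‖x‖ ^ β * ‖x - z‖ ^ (-β) = ρ ^ β := by
      rw [hρ, Real.div_rpow hx0.le hv0.le, Real.rpow_neg hv0.le, div_eq_mul_inv]
    rw [hρβ, norm_mul, Real.norm_eq_abs, Real.norm_eq_abs]
    have hmnn : 0 ≤ m (x - z) := by positivity
    rcases le_or_gt (‖x‖ / 2) ‖x - z‖ with h | h
    · have hρ2 : ρ ≤ 2 := by rw [hρ, div_le_iff₀ hv0]; linarith
      have h1 : |ρ - 1| ≤ ‖z‖ * (2 / ‖x‖) := by
        have h2 : ρ - 1 = (‖x‖ - ‖x - z‖) / ‖x - z‖ := by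
          rw [hρ, sub_div, div_self hv0.ne']
        have h3 : |‖x‖ - ‖x - z‖| ≤ ‖z‖ := by
          simpa using abs_norm_sub_norm_le x (x - z)
        rw [h2, abs_div, abs_of_pos hv0, div_eq_mul_inv]
        gcongr
        rw [inv_le_comm₀ hv0 (by positivity), inv_div]
        exact h
      have h4 := (abs_rpow_sub_one_le_of_le hρ0 hβ.1.le hβN.2.le).trans
        (abs_pow_sub_one_le hρ0.le hρ2 N)
      have h5 : 0 ≤ (D * 2 ^ (N + 1) / ‖x‖) * m (x - z) := by positivity
      calc |biharmonicHeatKernel N z 1| * |ρ ^ β - 1|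
          ≤ |biharmonicHeatKernel N z 1| * (N * 2 ^ N * (‖z‖ * (2 / ‖x‖))) := by
            gcongr
            exact h4.trans (by gcongr)
        _ = (N * 2 ^ N * 2 / ‖x‖) * (‖z‖ * |biharmonicHeatKernel N z 1|) := by ring
        _ ≤ _ := by linarith
    · have hz2 : ‖x‖ / 2 ≤ ‖z‖ := by
        have := norm_sub_norm_le x z
        linarith
      have hρ1 : 1 ≤ ρ := by rw [hρ, le_div_iff₀ hv0]; linarith
      have h1 : |ρ ^ β - 1| ≤ ‖x‖ ^ b * ‖x - z‖ ^ (-b) := by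
        have h2 := Real.one_le_rpow hρ1 hβ.1.le
        have h3 := Real.rpow_le_rpow_of_exponent_le hρ1 hβ.2
        rw [abs_of_nonneg (by linarith)]
        have h4 : ‖x‖ ^ b * ‖x - z‖ ^ (-b) = ρ ^ b := by
          rw [hρ, Real.div_rpow hx0.le hv0.le, Real.rpow_neg hv0.le, div_eq_mul_inv]
        linarith
      have h2 : ‖x‖ ^ b ≤ ‖x‖ ^ N := by
        rw [← Real.rpow_natCast]
        exact Real.rpow_le_rpow_of_exponent_le hx hb.2.le
      have h3 : |biharmonicHeatKernel N z 1| * ‖x‖ ^ N * ‖x‖ * (1 + ‖x - z‖) ^ (N + 1) ≤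
          D * 2 ^ (N + 1) := by
        have h4 : ‖x‖ ≤ 2 * (1 + ‖z‖) := by linarith
        have h5 : 1 + ‖x - z‖ ≤ 1 + ‖z‖ := by linarith
        calc |biharmonicHeatKernel N z 1| * ‖x‖ ^ N * ‖x‖ * (1 + ‖x - z‖) ^ (N + 1)
            = |biharmonicHeatKernel N z 1| * ‖x‖ ^ (N + 1) * (1 + ‖x - z‖) ^ (N + 1) := by ring
          _ ≤ |biharmonicHeatKernel N z 1| * (2 * (1 + ‖z‖)) ^ (N + 1) *
              (1 + ‖z‖) ^ (N + 1) := by gcongr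
          _ = ((1 + ‖z‖) ^ (2 * N + 2) * |biharmonicHeatKernel N z 1|) * 2 ^ (N + 1) := by
            rw [mul_pow]; ring
          _ ≤ D * 2 ^ (N + 1) := by gcongr; exact hD z
      have h6 : |biharmonicHeatKernel N z 1| * ‖x‖ ^ N ≤
          D * 2 ^ (N + 1) / ‖x‖ * (1 + ‖x - z‖) ^ (-((N + 1 : ℕ) : ℝ)) := by
        rw [Real.rpow_neg (by positivity), Real.rpow_natCast, ← div_eq_mul_inv,
          le_div_iff₀ (by positivity), le_div_iff₀ hx0]
        linarith
      calc |biharmonicHeatKernel N z 1| * |ρ ^ β - 1|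
          ≤ |biharmonicHeatKernel N z 1| * (‖x‖ ^ N * ‖x - z‖ ^ (-b)) := by
            gcongr
            exact h1.trans (by gcongr)
        _ = |biharmonicHeatKernel N z 1| * ‖x‖ ^ N * ‖x - z‖ ^ (-b) := by ring
        _ ≤ D * 2 ^ (N + 1) / ‖x‖ * (1 + ‖x - z‖) ^ (-((N + 1 : ℕ) : ℝ)) * ‖x - z‖ ^ (-b) := by
            gcongr
        _ = (D * 2 ^ (N + 1) / ‖x‖) * m (x - z) := by rw [hm]; ring
        _ ≤ _ := by
            have : 0 ≤ (N * 2 ^ N * 2 / ‖x‖) * (‖z‖ * |biharmonicHeatKernel N z 1|) := by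
              positivity
            linarith
  rw [heq, ← Real.norm_eq_abs]
  have h1 := hkI.const_mul (N * 2 ^ N * 2 / ‖x‖)
  have h2 := (hmI.comp_sub_left x).const_mul (D * 2 ^ (N + 1) / ‖x‖)
  refine (norm_integral_le_of_norm_le (h1.add h2) hbound).trans ?_
  simp only [Pi.add_apply]
  rw [integral_add h1 h2, integral_const_mul, integral_const_mul,
    integral_sub_left_eq_self m volume x, ← hJ1, ← hJ2, le_div_iff₀ hx0, add_mul]
  have e1 : N * 2 ^ N * 2 / ‖x‖ * J1 * ‖x‖ = N * 2 ^ N * 2 * J1 := by field_simp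
  have e2 : D * 2 ^ (N + 1) / ‖x‖ * J2 * ‖x‖ = D * 2 ^ (N + 1) * J2 := by field_simp
  rw [e1, e2]
  linarith

lemma exists_abs_semigroup_one_le {N : ℕ} (hN : 1 ≤ N) {β : ℝ} (hβ : β ∈ Set.Ioo (0 : ℝ) N) :
    ∃ K : ℝ, 0 < K ∧ ∀ x : EuclideanSpace ℝ (Fin N),
      |biharmonicHeatSemigroup N 1 (powerDatum N β) x| ≤ K / (‖x‖ ^ β + 1) := by
  obtain ⟨C, hC0, hC⟩ := exists_abs_norm_rpow_mul_semigroup_sub_one_le hN hβ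
  obtain ⟨D, hD⟩ := (isCompact_closedBall (0 : EuclideanSpace ℝ (Fin N)) 1).exists_bound_of_continuousOn
    (continuous_semigroup_one hN hβ).continuousOn
  refine ⟨2 * (1 + C + |D|), by positivity, fun x => ?_⟩
  have hp : 0 ≤ ‖x‖ ^ β := by positivity
  rw [le_div_iff₀ (by positivity)]
  set U := biharmonicHeatSemigroup N 1 (powerDatum N β) x with hU
  have hU0 := abs_nonneg U
  rcases le_total ‖x‖ 1 with h | h
  · have h1 : |U| ≤ |D| := (hD x (by simpa using h)).trans (le_abs_self D)
    have h2 := Real.rpow_le_one (norm_nonneg x) h hβ.1.le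
    nlinarith
  · have h1 := (hC β ⟨hβ.1, le_rfl⟩ x h).trans (div_le_self hC0.le h)
    have h2 := Real.one_le_rpow h hβ.1.le
    have h3 := abs_sub_abs_le_abs_sub (‖x‖ ^ β * U) 1
    rw [abs_mul, abs_of_nonneg hp, abs_one] at h3
    nlinarith [abs_nonneg D]

lemma exists_le_semigroup_one {N : ℕ} (hN : 1 ≤ N) {β : ℝ} (hβ : β ∈ Set.Ioo (0 : ℝ) N)
    (hpos : ∀ x, 0 < biharmonicHeatSemigroup N 1 (powerDatum N β) x) :
    ∃ K : ℝ, 0 < K ∧ ∀ x : EuclideanSpace ℝ (Fin N),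
      K / (‖x‖ ^ β + 1) ≤ biharmonicHeatSemigroup N 1 (powerDatum N β) x := by
  obtain ⟨C, hC0, hC⟩ := exists_abs_norm_rpow_mul_semigroup_sub_one_le hN hβ
  obtain ⟨y, -, hy⟩ := (isCompact_closedBall (0 : EuclideanSpace ℝ (Fin N))
    (1 + 2 * C)).exists_isMinOn ⟨0, by simp; positivity⟩ (continuous_semigroup_one hN hβ).continuousOn
  refine ⟨min (1 / 2) (biharmonicHeatSemigroup N 1 (powerDatum N β) y),
    lt_min (by norm_num) (hpos y), fun x => ?_⟩
  have hp : 0 ≤ ‖x‖ ^ β := by positivity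
  rw [div_le_iff₀ (by positivity)]
  rcases le_total ‖x‖ (1 + 2 * C) with h | h
  · have h1 := hy (show x ∈ Metric.closedBall 0 (1 + 2 * C) by simpa using h)
    simp only [Set.mem_ofPred_eq] at h1
    refine (min_le_right _ _).trans ?_
    nlinarith [hpos x]
  · have h1 := hC β ⟨hβ.1, le_rfl⟩ x (by linarith)
    have h2 : C / ‖x‖ ≤ 1 / 2 := by
      rw [div_le_iff₀ (by linarith)]; linarith
    have h3 := (abs_le.1 (h1.trans h2)).1
    refine (min_le_left _ _).trans ?_
    nlinarith [hpos x]

/-! ### Stability of positivity, and sign change near `β = N` -/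

/-- Positivity of the solution is an open condition on the exponent: large `x` are controlled by
the uniform asymptotics, the others by compactness. -/
lemma exists_forall_profileIntegral_pos {N : ℕ} (hN : 1 ≤ N) {β₀ : ℝ}
    (hβ₀ : β₀ ∈ Set.Ioo (0 : ℝ) N) (hpos : ∀ x, 0 < profileIntegral N β₀ x) :
    ∃ β₁ ∈ Set.Ioo β₀ (N : ℝ), ∀ β ∈ Set.Icc β₀ β₁, ∀ x, 0 < profileIntegral N β x := by
  obtain ⟨b, hb1, hb2⟩ := exists_between hβ₀.2
  obtain ⟨C, hC0, hC⟩ := exists_abs_norm_rpow_mul_semigroup_sub_one_le hN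
    (b := b) ⟨hβ₀.1.trans hb1, hb2⟩
  have hfar : ∀ β ∈ Set.Ioc (0 : ℝ) b, ∀ x : EuclideanSpace ℝ (Fin N), 1 + C < ‖x‖ →
      0 < profileIntegral N β x := by
    intro β hβ x hx
    obtain ⟨D, hD0, hD⟩ := exists_semigroup_eq_mul_profileIntegral hN ⟨hβ.1, hβ.2.trans_lt hb2⟩
    have h1 := hC β hβ x (by linarith)
    have h2 : C / ‖x‖ < 1 := by
      rw [div_lt_one (by linarith)]; linarith
    have h3 := (abs_lt.1 (h1.trans_lt h2)).1
    rw [hD x] at h3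
    have h4 : 0 < ‖x‖ ^ β := Real.rpow_pos_of_pos (by linarith) _
    by_contra! hle
    nlinarith [mul_nonneg (mul_nonneg h4.le hD0.le) (neg_nonneg.2 hle)]
  have hnear : ∀ᶠ β in 𝓝 β₀, ∀ x ∈ Metric.closedBall (0 : EuclideanSpace ℝ (Fin N)) (1 + C),
      0 < profileIntegral N β x :=
    (isCompact_closedBall _ _).eventually_forall_of_forall_eventually fun x _ =>
      (continuousAt_profileIntegral hN hβ₀ x).eventually (lt_mem_nhds (hpos x))
  obtain ⟨ε, hε, hball⟩ := Metric.eventually_nhds_iff.1 hnear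
  refine ⟨min b (β₀ + ε / 2), ⟨lt_min hb1 (by linarith), (min_le_left _ _).trans_lt hb2⟩,
    fun β hβ x => ?_⟩
  rcases le_or_gt ‖x‖ (1 + C) with h | h
  · refine hball ?_ x (by simpa using h)
    rw [Real.dist_eq, abs_of_nonneg (by linarith [hβ.1])]
    linarith [hβ.2.trans (min_le_right _ _)]
  · exact hfar β ⟨hβ₀.1.trans_le hβ.1, hβ.2.trans (min_le_left _ _)⟩ x h

/-- The biharmonic heat kernel changes sign. If it were nonnegative, `1 - cos 2θ ≤ 4 (1 - cos θ)`
would give `1 - e^{-|2ξ|⁴} ≤ 4 (1 - e^{-|ξ|⁴})`, which fails for small `ξ`: the symbol has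
vanishing second derivatives at the origin. -/
lemma exists_kernel_neg {N : ℕ} (hN : 1 ≤ N) :
    ∃ x : EuclideanSpace ℝ (Fin N), biharmonicHeatKernel N x 1 < 0 := by
  by_contra! hnn
  have hN' : Nontrivial (EuclideanSpace ℝ (Fin N)) :=
    Module.nontrivial_of_finrank_pos (R := ℝ) (by simpa using Nat.pos_of_ne_zero (by omega))
  -- with `q = e^{-|ξ|⁴}` the inequality reads `1 - q ^ 16 ≤ 4 (1 - q)`, which `q = 9 / 10` violates
  obtain ⟨ξ, hξ⟩ : ∃ ξ : EuclideanSpace ℝ (Fin N), Real.exp (-‖ξ‖ ^ 4) = 9 / 10 := by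
    have hlog : 0 ≤ -Real.log (9 / 10) := by
      have := Real.log_nonpos (by norm_num : (0 : ℝ) ≤ 9 / 10) (by norm_num)
      linarith
    obtain ⟨ξ, hξ⟩ := exists_norm_eq (EuclideanSpace ℝ (Fin N))
      (Real.rpow_nonneg hlog ((4 : ℕ) : ℝ)⁻¹)
    refine ⟨ξ, ?_⟩
    rw [hξ, Real.rpow_inv_natCast_pow hlog (by norm_num), neg_neg, Real.exp_log (by norm_num)]
  have hI : ∀ ζ : EuclideanSpace ℝ (Fin N), Integrable fun x : EuclideanSpace ℝ (Fin N) =>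
      biharmonicHeatKernel N x 1 * Real.cos (inner ℝ x ζ) := fun ζ =>
    (integrable_kernel N).mul_bdd (c := 1) (by fun_prop)
      (.of_forall fun ξ => by simpa using Real.abs_cos_le_one _)
  have hK1 : ∫ z : EuclideanSpace ℝ (Fin N), biharmonicHeatKernel N z 1 = 1 := by
    simpa using integral_kernel_mul_cos N 0
  have h2 : Real.exp (-‖(2 : ℝ) • ξ‖ ^ 4) = (9 / 10) ^ 16 := by
    rw [← hξ, ← Real.exp_nat_mul, norm_smul]
    congr 1
    simp
    ring
  have hle := integral_mono (μ := volume) ((integrable_kernel N).sub (hI ((2 : ℝ) • ξ)))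
    (((integrable_kernel N).sub (hI ξ)).const_mul 4) (fun x => by
      simp only [Pi.sub_apply]
      rw [real_inner_smul_right, Real.cos_two_mul]
      have hc := Real.neg_one_le_cos (inner ℝ x ξ)
      nlinarith [mul_nonneg (hnn x) (sq_nonneg (1 - Real.cos (inner ℝ x ξ)))])
  simp only [Pi.sub_apply] at hle
  rw [integral_const_mul, integral_sub (integrable_kernel N) (hI _),
    integral_sub (integrable_kernel N) (hI _), integral_kernel_mul_cos, integral_kernel_mul_cos,
    hK1, h2, hξ] at hle
  norm_num at hle

/-- For `β` near `N` the solution is close to a positive multiple of the kernel, which is negative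
somewhere. -/
lemma exists_profileIntegral_neg {N : ℕ} (hN : 1 ≤ N) :
    ∃ β₂ ∈ Set.Ioo (0 : ℝ) N, ∃ x, ∀ β ∈ Set.Ioo β₂ (N : ℝ), profileIntegral N β x < 0 := by
  have hN0 : (0 : ℝ) < N := by exact_mod_cast hN
  obtain ⟨x, hx⟩ := exists_kernel_neg hN
  have hlim : profileIntegral N N x < 0 := by
    have : biharmonicHeatKernel N x 1 = ((2 * Real.pi) ^ N)⁻¹ * profileIntegral N N x := by
      simp [biharmonicHeatKernel, profileIntegral]
    rw [this] at hx
    exact (pos_iff_neg_of_mul_neg hx).1 (by positivity)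
  have hc : ContinuousWithinAt (fun β : ℝ => profileIntegral N β x) (Set.Ioc (0 : ℝ) N) N :=
    ((continuousOn_profileIntegral hN) (N, x) ⟨⟨hN0, le_rfl⟩, trivial⟩).comp
      (f := fun β : ℝ => (β, x)) (by fun_prop) (fun β hβ => ⟨hβ, trivial⟩)
  have hev := hc.eventually (gt_mem_nhds hlim)
  rw [eventually_nhdsWithin_iff, Metric.eventually_nhds_iff] at hev
  obtain ⟨ε, hε, h⟩ := hev
  refine ⟨max (N / 2) (N - ε), ⟨lt_max_of_lt_left (by linarith), max_lt (by linarith)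
    (by linarith)⟩, x, fun β hβ => h ?_ ⟨?_, hβ.2.le⟩⟩
  · rw [Real.dist_eq, abs_of_nonpos (by linarith [hβ.2])]
    linarith [(le_max_right _ _).trans_lt hβ.1]
  · linarith [(le_max_left _ _).trans_lt hβ.1]

/-! ### A Bessel-type equation with nonnegative primitive -/

/-- A pair of functions `Φ, A` on the half-line with `Φ' = -A` and `A′ = Φ - 2 c A / t`. For
`2 c = N - 1` these are, up to a constant, the spherical mean of `cos` in dimension `N` (a Bessel
function of order `N / 2 - 1`) and minus its derivative. The bounds on `Φ` and `A` single out the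
solution regular at the origin, with `Φ 0 > 0`. -/
structure IsSphericalPair (c : ℝ) (Φ A : ℝ → ℝ) : Prop where
  hasDerivAt_fst : ∀ t, HasDerivAt Φ (-A t) t
  hasDerivAt_snd : ∀ t, 0 < t → HasDerivAt A (Φ t - 2 * c * A t / t) t
  continuous_snd : Continuous A
  abs_fst_le : ∀ t, |Φ t| ≤ Φ 0
  abs_snd_le : ∀ t, 0 ≤ t → |A t| ≤ Φ 0 * t
  fst_pos : ∀ t ∈ Set.Icc (0 : ℝ) 1, 0 < Φ t

namespace IsSphericalPair

variable {c : ℝ} {Φ A : ℝ → ℝ}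

lemma snd_zero (h : IsSphericalPair c Φ A) : A 0 = 0 := by
  simpa using h.abs_snd_le 0 le_rfl

lemma fst_zero_pos (h : IsSphericalPair c Φ A) : 0 < Φ 0 := h.fst_pos 0 (by simp)

lemma snd_pos (h : IsSphericalPair c Φ A) (hc : 0 ≤ c) {t : ℝ} (ht : t ∈ Set.Ioc (0 : ℝ) 1) :
    0 < A t := by
  have hd : ∀ s, 0 < s → HasDerivAt (fun s => s ^ (2 * c) * A s) (s ^ (2 * c) * Φ s) s := by
    intro s hs
    have h1 := (Real.hasDerivAt_rpow_const (p := 2 * c) (Or.inl hs.ne')).mul (h.hasDerivAt_snd s hs)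
    refine HasDerivAt.congr_deriv (h1) ?_
    rw [Real.rpow_sub_one hs.ne']
    field_simp
    ring
  have hmono : StrictMonoOn (fun s => s ^ (2 * c) * A s) (Set.Icc 0 1) := by
    refine strictMonoOn_of_deriv_pos (convex_Icc 0 1) ?_ ?_
    · have := h.continuous_snd
      have h2 := Real.continuous_rpow_const (q := 2 * c) (by linarith)
      exact (h2.mul this).continuousOn
    · intro s hs
      rw [interior_Icc] at hs
      rw [(hd s hs.1).deriv]
      exact mul_pos (Real.rpow_pos_of_pos hs.1 _) (h.fst_pos s ⟨hs.1.le, hs.2.le⟩)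
  have h3 := hmono (by simp) ⟨ht.1.le, ht.2⟩ ht.1
  simp only [h.snd_zero, mul_zero] at h3
  exact (pos_iff_pos_of_mul_pos h3).1 (Real.rpow_pos_of_pos ht.1 _)

lemma continuous_weighted (h : IsSphericalPair c Φ A) (hc : 0 ≤ c) :
    Continuous fun t => t ^ c * A t :=
  (Real.continuous_rpow_const hc).mul h.continuous_snd

lemma hasDerivAt_primitive (h : IsSphericalPair c Φ A) (hc : 0 ≤ c) (z : ℝ) :
    HasDerivAt (fun z => ∫ t in (0 : ℝ)..z, t ^ c * A t) (z ^ c * A z) z :=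
  intervalIntegral.integral_hasDerivAt_right ((h.continuous_weighted hc).intervalIntegrable _ _)
    ((h.continuous_weighted hc).stronglyMeasurableAtFilter _ _) (h.continuous_weighted hc).continuousAt

lemma abs_weighted_le (h : IsSphericalPair c Φ A) {t : ℝ} (ht : 0 < t) :
    |t ^ c * A t| ≤ Φ 0 * t ^ (c + 1) := by
  rw [abs_mul, abs_of_pos (Real.rpow_pos_of_pos ht c), Real.rpow_add_one ht.ne']
  have := mul_le_mul_of_nonneg_left (h.abs_snd_le t ht.le) (Real.rpow_pos_of_pos ht c).le
  linarith

lemma abs_primitive_le (h : IsSphericalPair c Φ A) (hc : 0 ≤ c) {z : ℝ} (hz : 0 < z) :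
    |∫ t in (0 : ℝ)..z, t ^ c * A t| ≤ Φ 0 * z ^ (c + 2) := by
  have h1 := intervalIntegral.norm_integral_le_of_norm_le_const (a := 0) (b := z)
    (f := fun t => t ^ c * A t) (C := Φ 0 * z ^ (c + 1)) (fun t ht => by
      rw [Set.uIoc_of_le hz.le] at ht
      refine (h.abs_weighted_le ht.1).trans ?_
      have := h.fst_zero_pos
      gcongr
      · exact ht.1.le
      · exact ht.2)
  rw [Real.norm_eq_abs, sub_zero, abs_of_pos hz] at h1
  refine h1.trans (le_of_eq ?_)
  rw [mul_assoc, ← Real.rpow_add_one hz.ne']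
  congr 2
  ring

lemma primitive_pos_of_le_one (h : IsSphericalPair c Φ A) (hc : 0 ≤ c) {z : ℝ}
    (hz : z ∈ Set.Ioc (0 : ℝ) 1) : 0 < ∫ t in (0 : ℝ)..z, t ^ c * A t :=
  intervalIntegral.intervalIntegral_pos_of_pos_on
    ((h.continuous_weighted hc).intervalIntegrable _ _)
    (fun _ ht => mul_pos (Real.rpow_pos_of_pos ht.1 _) (h.snd_pos hc ⟨ht.1, ht.2.le.trans hz.2⟩))
    hz.1

lemma hasDerivAt_weighted (h : IsSphericalPair c Φ A) {t : ℝ} (ht : 0 < t) :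
    HasDerivAt (fun t => t ^ c * A t) (t ^ c * (Φ t - c * A t / t)) t := by
  refine HasDerivAt.congr_deriv ((Real.hasDerivAt_rpow_const (p := c) (Or.inl ht.ne')).mul (h.hasDerivAt_snd t ht)) ?_
  rw [Real.rpow_sub_one ht.ne']
  field_simp
  ring

/-- The function `w = t^c A` solves `w'' + (1 - c (c + 1) / t²) w = 0`. -/
lemma hasDerivAt_deriv_weighted (h : IsSphericalPair c Φ A) {t : ℝ} (ht : 0 < t) :
    HasDerivAt (fun t => t ^ c * (Φ t - c * A t / t))
      (-(1 - c * (c + 1) / t ^ 2) * (t ^ c * A t)) t := by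
  refine HasDerivAt.congr_deriv ((Real.hasDerivAt_rpow_const (p := c) (Or.inl ht.ne')).mul
    ((h.hasDerivAt_fst t).sub (((h.hasDerivAt_snd t ht).const_mul c).div (hasDerivAt_id t)
      ht.ne'))) ?_
  rw [Real.rpow_sub_one ht.ne']
  field_simp
  ring

/-- The primitive `W` of `w = t^c A` is nonnegative. With `q = 1 - c (c + 1) / t²`, the quantity
`Q = 2 W W'' - W'² + q W²` has `Q' = q' W² ≥ 0` and vanishes at the origin, so that `Q > 0` at a
first zero of `W`; but `Q = -W'² ≤ 0` there. -/
lemma primitive_nonneg (h : IsSphericalPair c Φ A) (hc : 0 ≤ c) {z : ℝ} (hz : 0 ≤ z) :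
    0 ≤ ∫ t in (0 : ℝ)..z, t ^ c * A t := by
  rcases hc.eq_or_lt with rfl | hc0
  · have h1 : ∫ t in (0 : ℝ)..z, A t = -Φ z - -Φ 0 :=
      intervalIntegral.integral_eq_sub_of_hasDerivAt
        (fun t _ => by simpa using (h.hasDerivAt_fst t).neg)
        (h.continuous_snd.intervalIntegrable _ _)
    simp only [Real.rpow_zero, one_mul, h1]
    linarith [le_abs_self (Φ z), h.abs_fst_le z]
  set W : ℝ → ℝ := fun z => ∫ t in (0 : ℝ)..z, t ^ c * A t with hW
  have hWd : ∀ z, HasDerivAt W (z ^ c * A z) z := h.hasDerivAt_primitive hc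
  have hWc : Continuous W := continuous_iff_continuousAt.2 fun z => (hWd z).continuousAt
  -- `c > 0` from here on, so that `q` is strictly increasing
  by_contra hneg
  replace hneg : W z < 0 := not_le.1 hneg
  have hz1 : 1 < z := by
    by_contra! hle
    rcases hz.eq_or_lt with rfl | hz0
    · simp [hW] at hneg
    · exact absurd (h.primitive_pos_of_le_one hc ⟨hz0, hle⟩) hneg.not_gt
  -- the first zero of `W`
  obtain ⟨z₀, hz₀1, hz₀, hbefore⟩ : ∃ z₀, 1 < z₀ ∧ W z₀ = 0 ∧ ∀ t ∈ Set.Ioo 0 z₀, 0 < W t := by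
    set S := {t | 1 ≤ t ∧ W t ≤ 0} with hS
    have hScl : IsClosed S := (isClosed_le continuous_const continuous_id).inter
      (isClosed_le hWc continuous_const)
    have hSne : S.Nonempty := ⟨z, hz1.le, hneg.le⟩
    have hSbd : BddBelow S := ⟨1, fun t ht => ht.1⟩
    have hmem := hScl.csInf_mem hSne hSbd
    have hlt : ∀ t ∈ Set.Ioo 0 (sInf S), 0 < W t := by
      intro t ht
      rcases le_or_gt t 1 with h1 | h1
      · exact h.primitive_pos_of_le_one hc ⟨ht.1, h1⟩
      · by_contra! hle
        exact (csInf_le hSbd ⟨h1.le, hle⟩).not_gt ht.2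
    have h1 : 1 < sInf S := by
      refine lt_of_le_of_ne hmem.1 fun heq => ?_
      have h2 := hmem.2
      rw [← heq] at h2
      exact (h.primitive_pos_of_le_one hc ⟨one_pos, le_rfl⟩).not_ge h2
    refine ⟨sInf S, h1, le_antisymm hmem.2 ?_, hlt⟩
    have hpos : 0 < sInf S := by linarith
    have : sInf S ∈ closure (Set.Ioo 0 (sInf S)) := by
      rw [closure_Ioo hpos.ne]
      exact ⟨hpos.le, le_rfl⟩
    exact closure_minimal (fun t ht => (hlt t ht).le) (isClosed_le continuous_const hWc) this
  set Q : ℝ → ℝ := fun t => 2 * W t * (t ^ c * (Φ t - c * A t / t)) - (t ^ c * A t) ^ 2 +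
    (1 - c * (c + 1) / t ^ 2) * W t ^ 2 with hQ
  have hQd : ∀ t, 0 < t → HasDerivAt Q (2 * (c * (c + 1)) / t ^ 3 * W t ^ 2) t := by
    intro t ht
    have hq : HasDerivAt (fun t : ℝ => 1 - c * (c + 1) / t ^ 2) (2 * (c * (c + 1)) / t ^ 3) t := by
      refine HasDerivAt.congr_deriv (((hasDerivAt_const t (c * (c + 1))).div (hasDerivAt_pow 2 t)
        (by positivity)).const_sub 1) ?_
      simp only [Nat.cast_ofNat]
      field_simp
      ring
    refine HasDerivAt.congr_deriv (((((hWd t).const_mul 2).mul (h.hasDerivAt_deriv_weighted ht)).sub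
      ((h.hasDerivAt_weighted ht).pow 2)).add (hq.mul ((hWd t).pow 2))) ?_
    simp only [Nat.cast_ofNat]
    ring
  have hQm : StrictMonoOn Q (Set.Ioc 0 z₀) := by
    refine strictMonoOn_of_deriv_pos (convex_Ioc 0 z₀)
      (fun t ht => (hQd t ht.1).continuousAt.continuousWithinAt) fun t ht => ?_
    rw [interior_Ioc] at ht
    rw [(hQd t ht.1).deriv]
    have := hbefore t ht
    have := ht.1
    positivity
  have hQ0 : Tendsto Q (𝓝[>] 0) (𝓝 0) := by
    set K := Φ 0 ^ 2 * (2 * (1 + c) + 1 + (1 + c * (c + 1))) with hK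
    have hsq : Tendsto (fun t : ℝ => K * t ^ 2) (𝓝[>] 0) (𝓝 0) := by
      have : Tendsto (fun t : ℝ => K * t ^ 2) (𝓝 0) (𝓝 (K * 0 ^ 2)) :=
        (by fun_prop : Continuous fun t : ℝ => K * t ^ 2).tendsto 0
      simpa using this.mono_left nhdsWithin_le_nhds
    refine squeeze_zero_norm' ?_ hsq
    filter_upwards [Ioo_mem_nhdsGT one_pos] with t ht
    have ht0 := ht.1
    have hσ := h.fst_zero_pos
    have htc0 : 0 < t ^ c := Real.rpow_pos_of_pos ht0 _
    have htc : t ^ c ≤ 1 := Real.rpow_le_one ht0.le ht.2.le hc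
    have hA := h.abs_snd_le t ht0.le
    have e1 : |t ^ c * A t| ≤ Φ 0 * t := by
      rw [abs_mul, abs_of_pos htc0]
      exact (mul_le_of_le_one_left (abs_nonneg _) htc).trans hA
    have e2 : |t ^ c * (Φ t - c * A t / t)| ≤ Φ 0 * (1 + c) := by
      rw [abs_mul, abs_of_pos htc0]
      refine (mul_le_of_le_one_left (abs_nonneg _) htc).trans ((abs_sub _ _).trans ?_)
      rw [abs_div, abs_mul, abs_of_nonneg hc, abs_of_pos ht0]
      have h5 : c * |A t| / t ≤ c * Φ 0 := by
        rw [div_le_iff₀ ht0]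
        nlinarith
      linarith [h.abs_fst_le t]
    have e3 : |W t| ≤ Φ 0 * t ^ 2 := by
      refine (h.abs_primitive_le hc ht0).trans ?_
      rw [Real.rpow_add ht0, Real.rpow_two]
      have : t ^ c * t ^ 2 ≤ t ^ 2 := mul_le_of_le_one_left (by positivity) htc
      gcongr
    have e4 : |1 - c * (c + 1) / t ^ 2| ≤ (1 + c * (c + 1)) / t ^ 2 := by
      refine (abs_sub _ _).trans ?_
      rw [abs_one, abs_of_nonneg (by positivity), add_div]
      gcongr
      rw [le_div_iff₀ (by positivity)]
      nlinarith [ht.2]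
    rw [Real.norm_eq_abs, hQ]
    refine (abs_add_le _ _).trans ((add_le_add (abs_sub _ _) le_rfl).trans ?_)
    rw [abs_mul (2 * W t), abs_mul 2, abs_mul _ (W t ^ 2), abs_pow, abs_pow, abs_two]
    calc 2 * |W t| * |t ^ c * (Φ t - c * A t / t)| + |t ^ c * A t| ^ 2 +
          |1 - c * (c + 1) / t ^ 2| * |W t| ^ 2
        ≤ 2 * (Φ 0 * t ^ 2) * (Φ 0 * (1 + c)) + (Φ 0 * t) ^ 2 +
          (1 + c * (c + 1)) / t ^ 2 * (Φ 0 * t ^ 2) ^ 2 := by gcongr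
      _ = K * t ^ 2 := by
          rw [hK]
          field_simp
  have hz₀0 : 0 < z₀ := by linarith
  have hhalf : 0 ≤ Q (z₀ / 2) := by
    refine le_of_tendsto hQ0 ?_
    filter_upwards [Ioo_mem_nhdsGT (by linarith : 0 < z₀ / 2)] with t ht
    exact (hQm ⟨ht.1, by linarith [ht.2]⟩ ⟨by linarith, by linarith⟩ ht.2).le
  have hlast := hQm (a := z₀ / 2) (b := z₀) ⟨by linarith, by linarith⟩ ⟨hz₀0, le_rfl⟩ (by linarith)
  have hend : Q z₀ = -(z₀ ^ c * A z₀) ^ 2 := by simp [hQ, hz₀]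
  nlinarith [sq_nonneg (z₀ ^ c * A z₀)]

/-! ### Integration by parts against a decreasing weight -/

/-- The derivative of the weight `h = -r^c (r^{-a} e^{-r⁴})′` produced by one integration by parts:
its sign is that of a quadratic polynomial in `r⁴`. -/
lemma hasDerivAt_weight (a c : ℝ) {r : ℝ} (hr : 0 < r) :
    HasDerivAt (fun r : ℝ => (a * r ^ (c - a - 1) + 4 * r ^ (c - a + 3)) * Real.exp (-r ^ 4))
      (r ^ (c - a - 2) * Real.exp (-r ^ 4) *
        (a * (c - a - 1) + 4 * (c - 2 * a + 3) * r ^ 4 - 16 * (r ^ 4) ^ 2)) r := by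
  have hexp : HasDerivAt (fun r : ℝ => Real.exp (-r ^ 4)) (Real.exp (-r ^ 4) * (-(4 * r ^ 3))) r := by
    simpa using ((hasDerivAt_pow 4 r).neg).exp
  refine HasDerivAt.congr_deriv ((((Real.hasDerivAt_rpow_const (p := c - a - 1) (Or.inl hr.ne')).const_mul a).add
    ((Real.hasDerivAt_rpow_const (p := c - a + 3) (Or.inl hr.ne')).const_mul 4)).mul hexp) ?_
  have e1 : r ^ (c - a - 1 - 1) = r ^ (c - a - 2) := by congr 1; ring
  have e2 : r ^ (c - a - 1) = r ^ (c - a - 2) * r := by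
    rw [← Real.rpow_add_one hr.ne']; congr 1; ring
  have e3 : r ^ (c - a + 3 - 1) = r ^ (c - a - 2) * r ^ 4 := by
    rw [← Real.rpow_natCast, ← Real.rpow_add hr]; congr 1; push_cast; ring
  have e4 : r ^ (c - a + 3) = r ^ (c - a - 2) * r ^ 5 := by
    rw [← Real.rpow_natCast, ← Real.rpow_add hr]; congr 1; push_cast; ring
  simp only [Pi.add_apply]
  rw [e1, e2, e3, e4]
  ring

lemma tendsto_rpow_mul_exp_neg_pow_four (p : ℝ) :
    Tendsto (fun r : ℝ => r ^ p * Real.exp (-r ^ 4)) atTop (𝓝 0) := by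
  have h := tendsto_rpow_mul_exp_neg_mul_atTop_nhds_zero p 1 one_pos
  refine squeeze_zero' ?_ ?_ h
  · filter_upwards [eventually_ge_atTop 0] with r hr
    positivity
  · filter_upwards [eventually_ge_atTop 1] with r hr
    have hr0 : 0 ≤ r := by linarith
    gcongr
    have : r ^ 1 ≤ r ^ 4 := pow_le_pow_right₀ hr (by norm_num)
    linarith

/-- Positivity of the radial integral. Two integrations by parts replace `Φ` by the nonnegative
primitive `W` of `t^c A`, against minus the derivative of the weight `h`; the hypothesis `hP` says
that `h` is decreasing. -/
lemma integral_pos (h : IsSphericalPair c Φ A) (hc : 0 ≤ c) {a : ℝ} (ha : 0 < a)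
    (ha' : a < 2 * c + 1) (hac : c < a + 1)
    (hP : ∀ X : ℝ, 0 ≤ X → a * (c - a - 1) + 4 * (c - 2 * a + 3) * X - 16 * X ^ 2 ≤ 0)
    {s : ℝ} (hs : 0 < s) :
    0 < ∫ r in Set.Ioi (0 : ℝ), r ^ (2 * c - a) * Real.exp (-r ^ 4) * Φ (r * s) := by
  set W : ℝ → ℝ := fun z => ∫ t in (0 : ℝ)..z, t ^ c * A t with hW
  set P : ℝ → ℝ := fun r => a * (c - a - 1) + 4 * (c - 2 * a + 3) * r ^ 4 - 16 * (r ^ 4) ^ 2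
    with hPdef
  set g : ℝ → ℝ := fun r => r ^ (2 * c - a) * Real.exp (-r ^ 4) * Φ (r * s) with hg
  set T : ℝ → ℝ := fun r => r ^ (2 * c - a) * Real.exp (-r ^ 4) * (A (r * s) / s) +
    (a * r ^ (c - a - 1) + 4 * r ^ (c - a + 3)) * Real.exp (-r ^ 4) *
      (s ^ (-c - 2) * W (r * s)) with hT
  have hΦc : Continuous Φ := continuous_iff_continuousAt.2 fun t => (h.hasDerivAt_fst t).continuousAt
  have hσ := h.fst_zero_pos
  have hgi : IntegrableOn g (Set.Ioi 0) := by
    have h1 : IntegrableOn (fun r : ℝ => r ^ (2 * c - a) * Real.exp (-r ^ 4)) (Set.Ioi 0) := by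
      have := integrableOn_rpow_mul_exp_neg_rpow (p := 4) (s := 2 * c - a) (by linarith)
        (by norm_num)
      refine this.congr_fun (fun r hr => ?_) measurableSet_Ioi
      simp only
      norm_cast
    exact h1.mul_bdd (c := Φ 0) (by fun_prop) (.of_forall fun r => h.abs_fst_le _)
  -- `T` collects the boundary terms of the two integrations by parts
  have hTd : ∀ r, 0 < r → HasDerivAt T (g r + r ^ (c - a - 2) * Real.exp (-r ^ 4) * P r *
      (s ^ (-c - 2) * W (r * s))) r := by
    intro r hr
    have hrs : 0 < r * s := by positivity
    have hmul : HasDerivAt (fun r : ℝ => r * s) s r := by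
      simpa using (hasDerivAt_id r).mul_const s
    have hexp : HasDerivAt (fun r : ℝ => Real.exp (-r ^ 4))
        (Real.exp (-r ^ 4) * (-(4 * r ^ 3))) r := by
      simpa using ((hasDerivAt_pow 4 r).neg).exp
    have hAd := (HasDerivAt.comp (h₂ := A) r (h.hasDerivAt_snd (r * s) hrs) hmul).div_const s
    have hWd := (HasDerivAt.comp (h₂ := W) r (h.hasDerivAt_primitive hc (r * s)) hmul).const_mul
      (s ^ (-c - 2))
    refine HasDerivAt.congr_deriv (((((Real.hasDerivAt_rpow_const (p := 2 * c - a) (Or.inl hr.ne')).mul hexp).mul hAd).add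
      ((hasDerivAt_weight a c hr).mul hWd))) ?_
    simp only [hg, hPdef, Function.comp_apply, Pi.mul_apply]
    have e0 : s ^ (-c - 2) = (s ^ c)⁻¹ * (s ^ 2)⁻¹ := by
      rw [Real.rpow_sub hs, Real.rpow_neg hs.le, Real.rpow_two, div_eq_mul_inv]
    have e1 : (r * s) ^ c = r ^ c * s ^ c := Real.mul_rpow hr.le hs.le
    have e2 : r ^ (2 * c - a) = r ^ c * (r ^ (c - a - 1) * r) := by
      rw [← Real.rpow_add_one hr.ne', ← Real.rpow_add hr]; congr 1; ring
    have e3 : r ^ (2 * c - a - 1) = r ^ c * r ^ (c - a - 1) := by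
      rw [← Real.rpow_add hr]; congr 1; ring
    have e4 : r ^ (c - a + 3) = r ^ (c - a - 1) * r ^ 4 := by
      rw [← Real.rpow_natCast, ← Real.rpow_add hr]; congr 1; push_cast; ring
    have hsc : s ^ c ≠ 0 := (Real.rpow_pos_of_pos hs c).ne'
    rw [e0, e1, e2, e3, e4]
    field_simp
    ring
  have hTb : ∀ r, 0 < r → ‖T r‖ ≤ Φ 0 * ((1 + a) * (r ^ (2 * c - a + 1) * Real.exp (-r ^ 4)) +
      4 * (r ^ (2 * c - a + 5) * Real.exp (-r ^ 4))) := by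
    intro r hr
    have hrs : 0 < r * s := by positivity
    have hA : |A (r * s) / s| ≤ Φ 0 * r := by
      rw [abs_div, abs_of_pos hs, div_le_iff₀ hs]
      linarith [h.abs_snd_le (r * s) hrs.le]
    have hW' : |s ^ (-c - 2) * W (r * s)| ≤ Φ 0 * r ^ (c + 2) := by
      rw [abs_mul, abs_of_pos (Real.rpow_pos_of_pos hs _)]
      calc s ^ (-c - 2) * |W (r * s)| ≤ s ^ (-c - 2) * (Φ 0 * (r * s) ^ (c + 2)) := by
            gcongr; exact h.abs_primitive_le hc hrs
        _ = Φ 0 * r ^ (c + 2) := by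
            have : s ^ (-c - 2) * s ^ (c + 2) = 1 := by
              rw [← Real.rpow_add hs, show -c - 2 + (c + 2) = 0 by ring, Real.rpow_zero]
            rw [Real.mul_rpow hr.le hs.le]
            linear_combination (Φ 0 * r ^ (c + 2)) * this
    have hnn : 0 ≤ (a * r ^ (c - a - 1) + 4 * r ^ (c - a + 3)) * Real.exp (-r ^ 4) := by positivity
    rw [Real.norm_eq_abs]
    refine (abs_add_le _ _).trans ?_
    rw [abs_mul, abs_of_nonneg (by positivity : 0 ≤ r ^ (2 * c - a) * Real.exp (-r ^ 4)),
      abs_mul _ (s ^ (-c - 2) * W (r * s)), abs_of_nonneg hnn]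
    calc _ ≤ r ^ (2 * c - a) * Real.exp (-r ^ 4) * (Φ 0 * r) +
          (a * r ^ (c - a - 1) + 4 * r ^ (c - a + 3)) * Real.exp (-r ^ 4) *
            (Φ 0 * r ^ (c + 2)) := by gcongr
      _ = _ := by
          have e1 : r ^ (2 * c - a + 1) = r ^ (2 * c - a) * r := Real.rpow_add_one hr.ne' _
          have e2 : r ^ (2 * c - a + 1) = r ^ (c - a - 1) * r ^ (c + 2) := by
            rw [← Real.rpow_add hr]; congr 1; ring
          have e3 : r ^ (2 * c - a + 5) = r ^ (c - a + 3) * r ^ (c + 2) := by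
            rw [← Real.rpow_add hr]; congr 1; ring
          rw [e3]
          linear_combination (-Φ 0 * Real.exp (-r ^ 4)) * e1 - a * Φ 0 * Real.exp (-r ^ 4) * e2
  have hT0 : Tendsto T (𝓝[>] 0) (𝓝 0) := by
    refine squeeze_zero_norm' (eventually_mem_nhdsWithin.mono hTb) ?_
    have e1 : Continuous fun r : ℝ => r ^ (2 * c - a + 1) :=
      Real.continuous_rpow_const (by linarith)
    have e2 : Continuous fun r : ℝ => r ^ (2 * c - a + 5) :=
      Real.continuous_rpow_const (by linarith)
    have e3 : Continuous fun r : ℝ => Φ 0 * ((1 + a) * (r ^ (2 * c - a + 1) * Real.exp (-r ^ 4)) +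
      4 * (r ^ (2 * c - a + 5) * Real.exp (-r ^ 4))) := by fun_prop
    have e4 := (e3.tendsto 0).mono_left (nhdsWithin_le_nhds (s := Set.Ioi 0))
    rw [Real.zero_rpow (by linarith), Real.zero_rpow (by linarith)] at e4
    simpa using e4
  have hTinf : Tendsto T atTop (𝓝 0) := by
    refine squeeze_zero_norm' ((eventually_gt_atTop 0).mono hTb) ?_
    have := (((tendsto_rpow_mul_exp_neg_pow_four (2 * c - a + 1)).const_mul (1 + a)).add
      ((tendsto_rpow_mul_exp_neg_pow_four (2 * c - a + 5)).const_mul 4)).const_mul (Φ 0)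
    simpa using this
  -- `Y` is a primitive of the nonnegative integrand left after the two integrations by parts
  set Y : ℝ → ℝ := fun r => (∫ u in (0 : ℝ)..r, g u) - T r with hY
  have hgint : ∀ r, 0 < r → IntervalIntegrable g volume 0 r := fun r hr => by
    rw [intervalIntegrable_iff_integrableOn_Ioc_of_le hr.le]
    exact hgi.mono_set Set.Ioc_subset_Ioi_self
  have hgc : ContinuousOn g (Set.Ioi 0) := by
    intro r hr
    have hr' : (0 : ℝ) < r := hr
    have : ContinuousAt (fun r : ℝ => r ^ (2 * c - a)) r :=
      Real.continuousAt_rpow_const r _ (Or.inl hr'.ne')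
    exact ContinuousAt.continuousWithinAt (by fun_prop)
  have hYd : ∀ r, 0 < r → HasDerivAt Y (-(r ^ (c - a - 2) * Real.exp (-r ^ 4) * P r *
      (s ^ (-c - 2) * W (r * s)))) r := by
    intro r hr
    have h1 := intervalIntegral.integral_hasDerivAt_right (hgint r hr)
      (hgc.stronglyMeasurableAtFilter isOpen_Ioi r hr) (hgc.continuousAt (Ioi_mem_nhds hr))
    refine HasDerivAt.congr_deriv (h1.sub (hTd r hr)) ?_
    ring
  have hYc : ContinuousOn Y (Set.Ioi 0) := fun r hr =>
    (hYd r hr).continuousAt.continuousWithinAt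
  have hYmono : MonotoneOn Y (Set.Ioi 0) := by
    refine monotoneOn_of_deriv_nonneg (convex_Ioi 0) hYc ?_ ?_
    · rw [interior_Ioi]
      exact fun r hr => (hYd r hr).differentiableAt.differentiableWithinAt
    · intro r hr
      rw [interior_Ioi] at hr
      have hr' : (0 : ℝ) < r := hr
      rw [(hYd r hr).deriv]
      have h1 : 0 ≤ W (r * s) := h.primitive_nonneg hc (by positivity)
      have h2 : P r ≤ 0 := hP (r ^ 4) (by positivity)
      have h3 : 0 ≤ r ^ (c - a - 2) * Real.exp (-r ^ 4) * (s ^ (-c - 2) * W (r * s)) := by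
        positivity
      nlinarith [mul_nonneg h3 (neg_nonneg.2 h2)]
  obtain ⟨r₀, hr₀, hr₀'⟩ : ∃ r₀ : ℝ, 0 < r₀ ∧ ∀ r ∈ Set.Ioo 0 r₀, r * s ≤ 1 ∧ P r < 0 := by
    have h1 : ∀ᶠ r in 𝓝 (0 : ℝ), r * s < 1 ∧ P r < 0 := by
      refine Filter.Eventually.and ?_ ?_
      · exact (by fun_prop : Continuous fun r : ℝ => r * s).continuousAt.eventually
          (gt_mem_nhds (by simp))
      · refine (by fun_prop : Continuous P).continuousAt.eventually (gt_mem_nhds ?_)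
        simp only [hPdef]
        nlinarith
    obtain ⟨ε, hε, hball⟩ := Metric.eventually_nhds_iff.1 h1
    refine ⟨ε, hε, fun r hr => ?_⟩
    have := hball (y := r) (by rw [Real.dist_eq, sub_zero, abs_of_pos hr.1]; exact hr.2)
    exact ⟨this.1.le, this.2⟩
  have hYstrict : StrictMonoOn Y (Set.Ioo 0 r₀) := by
    refine strictMonoOn_of_deriv_pos (convex_Ioo 0 r₀) (hYc.mono fun r hr => hr.1) ?_
    intro r hr
    rw [interior_Ioo] at hr
    have hr' : (0 : ℝ) < r := hr.1
    rw [(hYd r hr.1).deriv]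
    have h1 : 0 < W (r * s) := h.primitive_pos_of_le_one hc ⟨by positivity, (hr₀' r hr).1⟩
    have h2 := (hr₀' r hr).2
    have h3 : 0 < r ^ (c - a - 2) * Real.exp (-r ^ 4) * (s ^ (-c - 2) * W (r * s)) := by
      positivity
    nlinarith [mul_pos h3 (neg_pos.2 h2)]
  have hY0 : Tendsto Y (𝓝[>] 0) (𝓝 0) := by
    have h1 : Tendsto (fun r => ∫ u in (0 : ℝ)..r, g u) (𝓝[>] 0) (𝓝 0) := by
      have h2 := intervalIntegral.continuousOn_primitive_interval (f := g) (μ := volume) (a := 0)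
        (b := 1) (by
          rw [Set.uIcc_of_le zero_le_one]
          exact (intervalIntegrable_iff_integrableOn_Icc_of_le zero_le_one).1 (hgint 1 one_pos))
      rw [Set.uIcc_of_le zero_le_one] at h2
      have h3 := h2 0 (by simp)
      have h4 : Tendsto (fun r => ∫ u in (0 : ℝ)..r, g u) (𝓝[Set.Icc 0 1] 0)
        (𝓝 (∫ u in (0 : ℝ)..0, g u)) := h3
      rw [intervalIntegral.integral_same] at h4
      refine h4.mono_left ?_
      rw [← nhdsWithin_Ioo_eq_nhdsGT (zero_lt_one' ℝ)]
      exact nhdsWithin_mono _ Set.Ioo_subset_Icc_self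
    simpa using h1.sub hT0
  have hYinf : Tendsto Y atTop (𝓝 (∫ r in Set.Ioi (0 : ℝ), g r)) := by
    simpa using (intervalIntegral_tendsto_integral_Ioi 0 hgi tendsto_id).sub hTinf
  have hr1 : r₀ / 3 ∈ Set.Ioo 0 r₀ := ⟨by linarith, by linarith⟩
  have hr2 : r₀ / 2 ∈ Set.Ioo 0 r₀ := ⟨by linarith, by linarith⟩
  have hlow : 0 ≤ Y (r₀ / 3) := by
    refine le_of_tendsto hY0 ?_
    filter_upwards [Ioo_mem_nhdsGT hr1.1] with t ht
    exact hYmono ht.1 hr1.1 ht.2.le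
  have hmid := hYstrict hr1 hr2 (by linarith)
  have hhigh : Y (r₀ / 2) ≤ ∫ r in Set.Ioi (0 : ℝ), g r := by
    refine ge_of_tendsto hYinf ?_
    filter_upwards [eventually_ge_atTop (r₀ / 2)] with t ht
    exact hYmono hr2.1 (hr2.1.trans_le ht) ht
  linarith

end IsSphericalPair

/-! ### Polar coordinates -/

section Sphere

variable {N : ℕ}

/-- Integration in polar coordinates, as an integral over the product of the sphere and the
half-line. -/
lemma integral_eq_integral_sphere_prod [Nontrivial (EuclideanSpace ℝ (Fin N))]
    (F : EuclideanSpace ℝ (Fin N) → ℝ) :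
    ∫ ξ, F ξ = ∫ p : Metric.sphere (0 : EuclideanSpace ℝ (Fin N)) 1 × Set.Ioi (0 : ℝ),
      F (p.2.1 • p.1.1) ∂((volume : Measure (EuclideanSpace ℝ (Fin N))).toSphere.prod
        (Measure.volumeIoiPow (N - 1))) := by
  have hmp := (volume : Measure (EuclideanSpace ℝ (Fin N))).measurePreserving_homeomorphUnitSphereProd
  rw [finrank_euclideanSpace_fin] at hmp
  rw [← hmp.integral_comp (Homeomorph.measurableEmbedding _),
    ← restrict_compl_singleton (μ := (volume : Measure (EuclideanSpace ℝ (Fin N)))) 0,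
    ← integral_subtype_comap (measurableSet_singleton _).compl F, restrict_compl_singleton]
  refine integral_congr_ae (.of_forall fun ξ => ?_)
  have hξ : ‖(ξ : EuclideanSpace ℝ (Fin N))‖ ≠ 0 := norm_ne_zero_iff.2 ξ.2
  simp [smul_smul, hξ]

lemma integrable_sphere_prod [Nontrivial (EuclideanSpace ℝ (Fin N))]
    {F : EuclideanSpace ℝ (Fin N) → ℝ} (hF : Integrable F) :
    Integrable (fun p : Metric.sphere (0 : EuclideanSpace ℝ (Fin N)) 1 × Set.Ioi (0 : ℝ) =>
      F (p.2.1 • p.1.1)) ((volume : Measure (EuclideanSpace ℝ (Fin N))).toSphere.prod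
        (Measure.volumeIoiPow (N - 1))) := by
  have hmp := (volume : Measure (EuclideanSpace ℝ (Fin N))).measurePreserving_homeomorphUnitSphereProd
  rw [finrank_euclideanSpace_fin] at hmp
  rw [← hmp.integrable_comp_emb (Homeomorph.measurableEmbedding _)]
  have h1 := (integrableOn_iff_comap_subtypeVal (measurableSet_singleton
    (0 : EuclideanSpace ℝ (Fin N))).compl).1 hF.integrableOn
  refine h1.congr (.of_forall fun ξ => ?_)
  have hξ : ‖(ξ : EuclideanSpace ℝ (Fin N))‖ ≠ 0 := norm_ne_zero_iff.2 ξ.2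
  simp [smul_smul, hξ]

lemma integral_volumeIoiPow (n : ℕ) (f : ℝ → ℝ) :
    ∫ r : Set.Ioi (0 : ℝ), f r ∂(Measure.volumeIoiPow n) =
      ∫ r in Set.Ioi (0 : ℝ), r ^ n * f r := by
  simp only [Measure.volumeIoiPow, ENNReal.ofReal]
  rw [integral_withDensity_eq_integral_smul,
    integral_subtype_comap measurableSet_Ioi fun a ↦ Real.toNNReal (a ^ n) • f a,
    setIntegral_congr_fun measurableSet_Ioi fun x hx ↦ ?_]
  · rw [NNReal.smul_def, Real.coe_toNNReal _ (pow_nonneg hx.out.le _), smul_eq_mul]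
  · exact (measurable_subtype_coe.pow_const _).real_toNNReal

/-- Polar coordinates for a function that is a product of an angular and a radial factor. -/
lemma integral_angular_mul_radial [Nontrivial (EuclideanSpace ℝ (Fin N))]
    (a : EuclideanSpace ℝ (Fin N) → ℝ) (b : ℝ → ℝ) :
    ∫ ξ : EuclideanSpace ℝ (Fin N), a (‖ξ‖⁻¹ • ξ) * b ‖ξ‖ =
      (∫ ω : Metric.sphere (0 : EuclideanSpace ℝ (Fin N)) 1, a ω ∂volume.toSphere) *
        ∫ r in Set.Ioi (0 : ℝ), r ^ (N - 1) * b r := by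
  rw [integral_eq_integral_sphere_prod, ← integral_volumeIoiPow, ← integral_prod_mul]
  refine integral_congr_ae (.of_forall fun p => ?_)
  have hp : (0 : ℝ) < p.2.1 := p.2.2
  have h1 : ‖(p.1 : EuclideanSpace ℝ (Fin N))‖ = 1 := by simp
  simp only [norm_smul, h1, Real.norm_of_nonneg hp.le, mul_one, smul_smul,
    inv_mul_cancel₀ hp.ne', one_smul]

lemma integral_eq_integral_Ioi_integral_sphere [Nontrivial (EuclideanSpace ℝ (Fin N))]
    {F : EuclideanSpace ℝ (Fin N) → ℝ} (hF : Integrable F) :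
    ∫ ξ, F ξ = ∫ r in Set.Ioi (0 : ℝ), r ^ (N - 1) *
      ∫ ω : Metric.sphere (0 : EuclideanSpace ℝ (Fin N)) 1, F (r • ω.1) ∂volume.toSphere := by
  rw [integral_eq_integral_sphere_prod, integral_prod_symm _ (integrable_sphere_prod hF),
    ← integral_volumeIoiPow]

lemma integrable_norm_pow_mul_exp (N k : ℕ) :
    Integrable fun ξ : EuclideanSpace ℝ (Fin N) => ‖ξ‖ ^ k * Real.exp (-‖ξ‖ ^ 4) := by
  have h := (quarticSchwartz N).integrable_pow_mul (μ := volume) k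
  refine h.congr (.of_forall fun ξ => ?_)
  simp only [quarticSchwartz_apply, Complex.norm_real, Real.norm_eq_abs, Real.abs_exp]

lemma integral_pow_mul_exp_neg_pow_four (k : ℕ) :
    IntegrableOn (fun r : ℝ => r ^ k * Real.exp (-r ^ 4)) (Set.Ioi 0) ∧
    0 < ∫ r in Set.Ioi (0 : ℝ), r ^ k * Real.exp (-r ^ 4) ∧
    4 * ∫ r in Set.Ioi (0 : ℝ), r ^ (k + 4) * Real.exp (-r ^ 4) =
      (k + 1) * ∫ r in Set.Ioi (0 : ℝ), r ^ k * Real.exp (-r ^ 4) := by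
  have key : ∀ k : ℕ, ∫ r in Set.Ioi (0 : ℝ), r ^ k * Real.exp (-r ^ 4) =
      1 / 4 * Real.Gamma ((k + 1) / 4) := by
    intro k
    have h := integral_rpow_mul_exp_neg_rpow (p := 4) (q := k) (by norm_num)
      (by linarith [(Nat.cast_nonneg k : (0 : ℝ) ≤ k)])
    rw [← h]
    refine setIntegral_congr_fun measurableSet_Ioi fun r hr => ?_
    norm_cast
  refine ⟨?_, ?_, ?_⟩
  · have h := integrableOn_rpow_mul_exp_neg_rpow (p := 4) (s := k)
      (by linarith [(Nat.cast_nonneg k : (0 : ℝ) ≤ k)]) (by norm_num)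
    refine h.congr_fun (fun r hr => ?_) measurableSet_Ioi
    norm_cast
  · rw [key]
    have : 0 < Real.Gamma ((k + 1) / 4) := Real.Gamma_pos_of_pos (by positivity)
    positivity
  · rw [key, key]
    have h1 : (((k + 4 : ℕ) : ℝ) + 1) / 4 = ((k : ℝ) + 1) / 4 + 1 := by push_cast; ring
    rw [h1, Real.Gamma_add_one (by positivity)]
    ring

/-! ### The spherical integral of the cosine -/

/-- The divergence theorem on the sphere, for vector fields `f(⟨e, ω⟩) e`: it is read off from
`∫ ∂ₑ(f(⟨e, ξ⟩ / |ξ|) |ξ|² e^{-|ξ|⁴}) dξ = 0` in polar coordinates. -/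
lemma integral_sphere_one_sub_sq_mul_deriv [Nontrivial (EuclideanSpace ℝ (Fin N))]
    {e : EuclideanSpace ℝ (Fin N)} (he : ‖e‖ = 1) {f f' : ℝ → ℝ} (hf : ∀ u, HasDerivAt f (f' u) u)
    (hf' : Continuous f') :
    ∫ ω : Metric.sphere (0 : EuclideanSpace ℝ (Fin N)) 1,
        f' (inner ℝ e ω.1) * (1 - inner ℝ e ω.1 ^ 2) ∂volume.toSphere =
      (N - 1) * ∫ ω : Metric.sphere (0 : EuclideanSpace ℝ (Fin N)) 1,
        f (inner ℝ e ω.1) * inner ℝ e ω.1 ∂volume.toSphere := by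
  have hN : 1 ≤ N := by
    have := Module.finrank_pos (R := ℝ) (M := EuclideanSpace ℝ (Fin N))
    simpa [Nat.one_le_iff_ne_zero, Nat.pos_iff_ne_zero] using this
  have hfc : Continuous f := continuous_iff_continuousAt.2 fun u => (hf u).continuousAt
  obtain ⟨C, hC⟩ := (isCompact_Icc (a := (-1 : ℝ)) (b := 1)).exists_bound_of_continuousOn
    hfc.continuousOn
  obtain ⟨C', hC'⟩ := (isCompact_Icc (a := (-1 : ℝ)) (b := 1)).exists_bound_of_continuousOn
    hf'.continuousOn
  have hu : ∀ ξ : EuclideanSpace ℝ (Fin N), inner ℝ e (‖ξ‖⁻¹ • ξ) ∈ Set.Icc (-1 : ℝ) 1 := by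
    intro ξ
    refine abs_le.1 ?_
    refine (abs_real_inner_le_norm _ _).trans ?_
    rw [he, one_mul, norm_smul, norm_inv, norm_norm]
    exact inv_mul_le_one
  set F : EuclideanSpace ℝ (Fin N) → ℝ := fun ξ =>
    f (inner ℝ e (‖ξ‖⁻¹ • ξ)) * (‖ξ‖ ^ 2 * Real.exp (-‖ξ‖ ^ 4)) with hF
  set F₁ : EuclideanSpace ℝ (Fin N) → ℝ := fun ξ =>
    f' (inner ℝ e (‖ξ‖⁻¹ • ξ)) * (1 - inner ℝ e (‖ξ‖⁻¹ • ξ) ^ 2) *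
      (‖ξ‖ * Real.exp (-‖ξ‖ ^ 4)) with hF₁
  set F₂ : EuclideanSpace ℝ (Fin N) → ℝ := fun ξ =>
    f (inner ℝ e (‖ξ‖⁻¹ • ξ)) * inner ℝ e (‖ξ‖⁻¹ • ξ) *
      ((2 * ‖ξ‖ - 4 * ‖ξ‖ ^ 5) * Real.exp (-‖ξ‖ ^ 4)) with hF₂
  have hm : Measurable f := hfc.measurable
  have hm' : Measurable f' := hf'.measurable
  have hFi : Integrable F := (integrable_norm_pow_mul_exp N 2).bdd_mul (c := C)
    (Measurable.aestronglyMeasurable (by fun_prop)) (.of_forall fun ξ => hC _ (hu ξ))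
  have hF₁i : Integrable F₁ := by
    have h1 : Integrable fun ξ : EuclideanSpace ℝ (Fin N) => ‖ξ‖ * Real.exp (-‖ξ‖ ^ 4) := by
      simpa using integrable_norm_pow_mul_exp N 1
    refine h1.bdd_mul (c := C' * 1) (Measurable.aestronglyMeasurable (by fun_prop))
      (.of_forall fun ξ => ?_)
    rw [norm_mul]
    refine mul_le_mul (hC' _ (hu ξ)) ?_ (norm_nonneg _) ((norm_nonneg _).trans (hC' _ (hu ξ)))
    have h2 := abs_le_one_iff_mul_self_le_one.1 (abs_le.2 (hu ξ))
    rw [Real.norm_eq_abs, abs_le]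
    constructor <;> nlinarith
  have hF₂i : Integrable F₂ := by
    have h1 : Integrable fun ξ : EuclideanSpace ℝ (Fin N) =>
        (2 * ‖ξ‖ - 4 * ‖ξ‖ ^ 5) * Real.exp (-‖ξ‖ ^ 4) := by
      refine (((integrable_norm_pow_mul_exp N 1).const_mul 2).sub
        ((integrable_norm_pow_mul_exp N 5).const_mul 4)).congr (.of_forall fun ξ => ?_)
      simp only [Pi.sub_apply]
      ring
    refine h1.bdd_mul (c := C * 1) (Measurable.aestronglyMeasurable (by fun_prop))
      (.of_forall fun ξ => ?_)
    rw [norm_mul]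
    exact mul_le_mul (hC _ (hu ξ)) (abs_le.2 (hu ξ)) (norm_nonneg _)
      ((norm_nonneg _).trans (hC _ (hu ξ)))
  have hline : ∀ ξ, HasLineDerivAt ℝ F (F₁ ξ + F₂ ξ) ξ e := by
    intro ξ
    unfold HasLineDerivAt
    by_cases hξ : ξ = 0
    · subst hξ
      have h0 : F₁ 0 + F₂ 0 = 0 := by simp [hF₁, hF₂]
      rw [h0]
      -- `F` is `O(s²)` along the line through the origin
      have hO : (fun s : ℝ => F (0 + s • e)) =O[𝓝 0] fun s : ℝ => s ^ 2 := by
        refine Asymptotics.IsBigO.of_bound C (.of_forall fun s => ?_)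
        rw [hF]
        simp only [zero_add]
        rw [norm_mul]
        refine mul_le_mul (hC _ (hu _)) ?_ (norm_nonneg _) ((norm_nonneg _).trans (hC _ (hu 0)))
        rw [norm_smul, he, mul_one, norm_mul, norm_pow, norm_pow, norm_norm,
          Real.norm_of_nonneg (Real.exp_pos _).le]
        refine mul_le_of_le_one_right (by positivity) (Real.exp_le_one_iff.2 ?_)
        rw [neg_nonpos]
        positivity
      have hF0 : F (0 + (0 : ℝ) • e) = 0 := by simp [hF]
      rw [hasDerivAt_iff_isLittleO, hF0]
      simp only [sub_zero, smul_zero]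
      exact hO.trans_isLittleO (by simpa using Asymptotics.isLittleO_pow_id one_lt_two)
    · have hr : 0 < ‖ξ‖ := norm_pos_iff.2 hξ
      have hline : HasDerivAt (fun s : ℝ => ξ + s • e) e 0 := by
        simpa using ((hasDerivAt_id (0 : ℝ)).smul_const e).const_add ξ
      have hn : HasDerivAt (fun s : ℝ => ‖ξ + s • e‖) (inner ℝ e ξ / ‖ξ‖) 0 := by
        have h1 := (hline.norm_sq).sqrt (by simpa using hξ)
        simp only [Real.sqrt_sq (norm_nonneg _)] at h1
        refine h1.congr_deriv ?_
        rw [zero_smul, add_zero, real_inner_comm]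
        field_simp
      have hi : HasDerivAt (fun s : ℝ => inner ℝ e (ξ + s • e)) 1 0 := by
        have h1 := (hasDerivAt_const (0 : ℝ) e).inner ℝ hline
        refine h1.congr_deriv ?_
        simp [he]
      have hq : HasDerivAt (fun s : ℝ => inner ℝ e (‖ξ + s • e‖⁻¹ • (ξ + s • e)))
          ((1 - (inner ℝ e ξ / ‖ξ‖) ^ 2) / ‖ξ‖) 0 := by
        have h1 := hi.div hn (by simpa using hξ)
        have h2 : (fun s : ℝ => inner ℝ e (‖ξ + s • e‖⁻¹ • (ξ + s • e))) =
            (fun s : ℝ => inner ℝ e (ξ + s • e)) / fun s : ℝ => ‖ξ + s • e‖ := by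
          ext s
          simp only [Pi.div_apply]
          rw [real_inner_smul_right, div_eq_inv_mul]
        rw [h2]
        refine h1.congr_deriv ?_
        simp only [zero_smul, add_zero]
        field_simp
      have hb : HasDerivAt (fun s : ℝ => ‖ξ + s • e‖ ^ 2 * Real.exp (-‖ξ + s • e‖ ^ 4))
          ((2 * ‖ξ‖ - 4 * ‖ξ‖ ^ 5) * Real.exp (-‖ξ‖ ^ 4) * (inner ℝ e ξ / ‖ξ‖)) 0 := by
        refine ((hn.pow 2).mul ((hn.pow 4).neg).exp).congr_deriv ?_
        simp only [zero_smul, add_zero, Pi.pow_apply, Pi.neg_apply]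
        push_cast
        ring
      refine ((HasDerivAt.comp (h₂ := f) (0 : ℝ) (hf _) hq).mul hb).congr_deriv ?_
      simp only [zero_smul, add_zero, hF₁, hF₂, Function.comp_apply, real_inner_smul_right]
      field_simp
  have hzero : ∫ ξ, (F₁ ξ + F₂ ξ) = 0 := by
    have h := integral_bilinear_hasLineDerivAt_right_eq_neg_left_of_integrable
      (μ := (volume : Measure (EuclideanSpace ℝ (Fin N)))) (B := ContinuousLinearMap.mul ℝ ℝ)
      (f := fun _ => 1) (f' := fun _ => 0) (g := F) (g' := fun ξ => F₁ ξ + F₂ ξ) (v := e)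
      (by simp) (by simp only [ContinuousLinearMap.mul_apply', one_mul]; exact hF₁i.add hF₂i)
      (by simpa using hFi)
      (fun ξ _ => hasDerivAt_const (0 : ℝ) (1 : ℝ)) (fun ξ _ => hline ξ)
    simpa using h
  rw [integral_add hF₁i hF₂i] at hzero
  have e1 : ∫ ξ, F₁ ξ = (∫ ω : Metric.sphere (0 : EuclideanSpace ℝ (Fin N)) 1,
      f' (inner ℝ e ω.1) * (1 - inner ℝ e ω.1 ^ 2) ∂volume.toSphere) *
        ∫ r in Set.Ioi (0 : ℝ), r ^ N * Real.exp (-r ^ 4) := by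
    rw [hF₁, integral_angular_mul_radial (fun η => f' (inner ℝ e η) * (1 - inner ℝ e η ^ 2))
      (fun r => r * Real.exp (-r ^ 4))]
    congr 2 with r
    rw [← mul_assoc, ← pow_succ, Nat.sub_add_cancel hN]
  have e2 : ∫ ξ, F₂ ξ = (∫ ω : Metric.sphere (0 : EuclideanSpace ℝ (Fin N)) 1,
      f (inner ℝ e ω.1) * inner ℝ e ω.1 ∂volume.toSphere) *
        ((1 - N) * ∫ r in Set.Ioi (0 : ℝ), r ^ N * Real.exp (-r ^ 4)) := by
    rw [hF₂, integral_angular_mul_radial (fun η => f (inner ℝ e η) * inner ℝ e η)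
      (fun r => (2 * r - 4 * r ^ 5) * Real.exp (-r ^ 4))]
    congr 1
    have h1 : ∀ r : ℝ, r ^ (N - 1) * ((2 * r - 4 * r ^ 5) * Real.exp (-r ^ 4)) =
        2 * (r ^ N * Real.exp (-r ^ 4)) - 4 * (r ^ (N + 4) * Real.exp (-r ^ 4)) := by
      intro r
      have : r ^ N = r ^ (N - 1) * r := by rw [← pow_succ, Nat.sub_add_cancel hN]
      rw [pow_add, this]
      ring
    simp_rw [h1]
    rw [integral_sub ((integral_pow_mul_exp_neg_pow_four N).1.const_mul 2)
      ((integral_pow_mul_exp_neg_pow_four (N + 4)).1.const_mul 4), integral_const_mul,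
      integral_const_mul, (integral_pow_mul_exp_neg_pow_four N).2.2]
    ring
  rw [e1, e2] at hzero
  have hM := (integral_pow_mul_exp_neg_pow_four N).2.1
  refine mul_right_cancel₀ hM.ne' ?_
  linarith

/-- The spherical integral of `cos (t ⟨e, ω⟩)`. -/
noncomputable def sphereCos (e : EuclideanSpace ℝ (Fin N)) (t : ℝ) : ℝ :=
  ∫ ω : Metric.sphere (0 : EuclideanSpace ℝ (Fin N)) 1, Real.cos (t * inner ℝ e ω.1)
    ∂volume.toSphere

/-- Minus the derivative of `sphereCos e`. -/
noncomputable def sphereSin (e : EuclideanSpace ℝ (Fin N)) (t : ℝ) : ℝ :=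
  ∫ ω : Metric.sphere (0 : EuclideanSpace ℝ (Fin N)) 1,
    inner ℝ e ω.1 * Real.sin (t * inner ℝ e ω.1) ∂volume.toSphere

lemma isSphericalPair_sphereCos_sphereSin [Nontrivial (EuclideanSpace ℝ (Fin N))]
    {e : EuclideanSpace ℝ (Fin N)} (he : ‖e‖ = 1) :
    IsSphericalPair (((N : ℝ) - 1) / 2) (sphereCos e) (sphereSin e) := by
  have hu : ∀ ω : Metric.sphere (0 : EuclideanSpace ℝ (Fin N)) 1, |inner ℝ e ω.1| ≤ 1 := by
    intro ω
    refine (abs_real_inner_le_norm _ _).trans ?_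
    simp [he]
  have hσ : 0 < (volume : Measure (EuclideanSpace ℝ (Fin N))).toSphere.real Set.univ :=
    have : NeZero (volume : Measure (EuclideanSpace ℝ (Fin N))).toSphere :=
      ⟨Measure.toSphere_ne_zero _⟩
    measureReal_univ_pos
  have hcosI : ∀ t, Integrable (fun ω : Metric.sphere (0 : EuclideanSpace ℝ (Fin N)) 1 =>
      Real.cos (t * inner ℝ e ω.1)) volume.toSphere := fun t =>
    Integrable.of_bound (by fun_prop) 1 (.of_forall fun ω => Real.abs_cos_le_one _)
  have hsinI : ∀ t, Integrable (fun ω : Metric.sphere (0 : EuclideanSpace ℝ (Fin N)) 1 =>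
      inner ℝ e ω.1 * Real.sin (t * inner ℝ e ω.1)) volume.toSphere := fun t =>
    Integrable.of_bound (by fun_prop) (1 * 1) (.of_forall fun ω => by
      rw [norm_mul]
      exact mul_le_mul (hu ω) (Real.abs_sin_le_one _) (norm_nonneg _) zero_le_one)
  have hsqI : ∀ t, Integrable (fun ω : Metric.sphere (0 : EuclideanSpace ℝ (Fin N)) 1 =>
      inner ℝ e ω.1 ^ 2 * Real.cos (t * inner ℝ e ω.1)) volume.toSphere := fun t =>
    Integrable.of_bound (by fun_prop) (1 ^ 2 * 1) (.of_forall fun ω => by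
      rw [norm_mul, norm_pow]
      exact mul_le_mul (pow_le_pow_left₀ (norm_nonneg _) (hu ω) 2) (Real.abs_cos_le_one _)
        (norm_nonneg _) (by norm_num))
  have hcosD : ∀ t, HasDerivAt (sphereCos e) (-sphereSin e t) t := by
    intro t
    have h := (hasDerivAt_integral_of_dominated_loc_of_deriv_le (x₀ := t)
      (μ := (volume : Measure (EuclideanSpace ℝ (Fin N))).toSphere)
      (F := fun t (ω : Metric.sphere (0 : EuclideanSpace ℝ (Fin N)) 1) =>
        Real.cos (t * inner ℝ e ω.1))
      (F' := fun t (ω : Metric.sphere (0 : EuclideanSpace ℝ (Fin N)) 1) =>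
        -(inner ℝ e ω.1 * Real.sin (t * inner ℝ e ω.1)))
      (bound := fun _ => 1 * 1) univ_mem
      (.of_forall fun s => (hcosI s).aestronglyMeasurable) (hcosI t)
      (hsinI t).neg.aestronglyMeasurable
      (.of_forall fun ω s _ => by
        rw [norm_neg, norm_mul]
        exact mul_le_mul (hu ω) (Real.abs_sin_le_one _) (norm_nonneg _) zero_le_one)
      (integrable_const _)
      (.of_forall fun ω s _ => by
        refine (((hasDerivAt_id s).mul_const (inner ℝ e ω.1)).cos).congr_deriv ?_
        simp only [id]
        ring)).2
    rw [integral_neg] at h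
    exact h
  have hsinD : ∀ t, HasDerivAt (sphereSin e)
      (∫ ω : Metric.sphere (0 : EuclideanSpace ℝ (Fin N)) 1,
        inner ℝ e ω.1 ^ 2 * Real.cos (t * inner ℝ e ω.1) ∂volume.toSphere) t := by
    intro t
    exact (hasDerivAt_integral_of_dominated_loc_of_deriv_le (x₀ := t)
      (μ := (volume : Measure (EuclideanSpace ℝ (Fin N))).toSphere)
      (F := fun t (ω : Metric.sphere (0 : EuclideanSpace ℝ (Fin N)) 1) =>
        inner ℝ e ω.1 * Real.sin (t * inner ℝ e ω.1))
      (F' := fun t (ω : Metric.sphere (0 : EuclideanSpace ℝ (Fin N)) 1) =>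
        inner ℝ e ω.1 ^ 2 * Real.cos (t * inner ℝ e ω.1))
      (bound := fun _ => 1 ^ 2 * 1) univ_mem
      (.of_forall fun s => (hsinI s).aestronglyMeasurable) (hsinI t)
      (hsqI t).aestronglyMeasurable
      (.of_forall fun ω s _ => by
        rw [norm_mul, norm_pow]
        exact mul_le_mul (pow_le_pow_left₀ (norm_nonneg _) (hu ω) 2) (Real.abs_cos_le_one _)
          (norm_nonneg _) (by norm_num))
      (integrable_const _)
      (.of_forall fun ω s _ => by
        refine ((((hasDerivAt_id s).mul_const (inner ℝ e ω.1)).sin).const_mul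
          (inner ℝ e ω.1)).congr_deriv ?_
        simp only [id]
        ring)).2
  have hcos0 : sphereCos e 0 =
      (volume : Measure (EuclideanSpace ℝ (Fin N))).toSphere.real Set.univ := by
    simp [sphereCos, -Measure.toSphere_real_apply_univ]
  refine ⟨hcosD, fun t ht => ?_, continuous_iff_continuousAt.2 fun t => (hsinD t).continuousAt,
    fun t => ?_, fun t ht => ?_, fun t ht => ?_⟩
  · refine (hsinD t).congr_deriv ?_
    have h := integral_sphere_one_sub_sq_mul_deriv he (f := fun u => Real.sin (t * u))
      (f' := fun u => t * Real.cos (t * u)) (fun u => by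
        refine (((hasDerivAt_id u).const_mul t).sin).congr_deriv ?_
        simp only [id]
        ring) (by fun_prop)
    have h1 : ∀ ω : Metric.sphere (0 : EuclideanSpace ℝ (Fin N)) 1,
        t * Real.cos (t * inner ℝ e ω.1) * (1 - inner ℝ e ω.1 ^ 2) =
        t * Real.cos (t * inner ℝ e ω.1) -
          t * (inner ℝ e ω.1 ^ 2 * Real.cos (t * inner ℝ e ω.1)) := fun ω => by ring
    simp_rw [h1] at h
    rw [integral_sub ((hcosI t).const_mul t) ((hsqI t).const_mul t), integral_const_mul,
      integral_const_mul] at h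
    have h2 : ∫ ω : Metric.sphere (0 : EuclideanSpace ℝ (Fin N)) 1,
        Real.sin (t * inner ℝ e ω.1) * inner ℝ e ω.1 ∂volume.toSphere = sphereSin e t := by
      simp_rw [mul_comm (Real.sin _)]
      rfl
    rw [h2] at h
    change t * sphereCos e t - _ = _ at h
    rw [eq_sub_iff_add_eq, ← eq_sub_iff_add_eq', div_eq_iff ht.ne']
    linarith
  · rw [hcos0, ← Real.norm_eq_abs, ← one_mul (Measure.real _ _)]
    exact norm_integral_le_of_norm_le_const (.of_forall fun ω => Real.abs_cos_le_one _)
  · rw [hcos0, mul_comm, ← Real.norm_eq_abs]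
    refine norm_integral_le_of_norm_le_const (.of_forall fun ω => ?_)
    rw [norm_mul]
    calc |inner ℝ e ω.1| * |Real.sin (t * inner ℝ e ω.1)| ≤ 1 * |t * inner ℝ e ω.1| :=
          mul_le_mul (hu ω) Real.abs_sin_le_abs (abs_nonneg _) zero_le_one
      _ ≤ t := by
          rw [one_mul, abs_mul, abs_of_nonneg ht]
          exact mul_le_of_le_one_right ht (hu ω)
  · have h1 : ∫ _ω : Metric.sphere (0 : EuclideanSpace ℝ (Fin N)) 1, Real.cos 1 ∂volume.toSphere ≤
        sphereCos e t := by
      refine integral_mono (integrable_const _) (hcosI t) fun ω => ?_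
      simp only
      rw [← Real.cos_abs (t * inner ℝ e ω.1)]
      refine Real.cos_le_cos_of_nonneg_of_le_pi (abs_nonneg _) (by linarith [Real.pi_gt_three]) ?_
      rw [abs_mul, abs_of_nonneg ht.1]
      nlinarith [hu ω, ht.1, ht.2, abs_nonneg (inner ℝ e ω.1)]
    refine lt_of_lt_of_le ?_ h1
    rw [integral_const, smul_eq_mul]
    exact mul_pos hσ Real.cos_one_pos

/-- The oscillatory integral in polar coordinates. -/
lemma profileIntegral_smul_eq (hN : 1 ≤ N) {β : ℝ} (hβ : β ∈ Set.Ioo (0 : ℝ) N)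
    (e : EuclideanSpace ℝ (Fin N)) (s : ℝ) :
    profileIntegral N β (s • e) =
      ∫ r in Set.Ioi (0 : ℝ), r ^ (β - 1) * Real.exp (-r ^ 4) * sphereCos e (r * s) := by
  have hN' : Nontrivial (EuclideanSpace ℝ (Fin N)) :=
    Module.nontrivial_of_finrank_pos (R := ℝ) (by simpa using Nat.pos_of_ne_zero (by omega))
  have hI : Integrable fun ξ : EuclideanSpace ℝ (Fin N) =>
      Real.cos (inner ℝ (s • e) ξ) * (Real.exp (-‖ξ‖ ^ 4) * ‖ξ‖ ^ (β - N)) :=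
    (integrable_exp_mul_norm_rpow hN ⟨hβ.1, hβ.2.le⟩).bdd_mul (c := 1) (by fun_prop)
      (.of_forall fun ξ => Real.abs_cos_le_one _)
  rw [profileIntegral, integral_eq_integral_Ioi_integral_sphere hI]
  refine setIntegral_congr_fun measurableSet_Ioi fun r hr => ?_
  have hr' : (0 : ℝ) < r := hr
  have h1 : ∀ ω : Metric.sphere (0 : EuclideanSpace ℝ (Fin N)) 1, ‖r • ω.1‖ = r := fun ω => by
    rw [norm_smul, Real.norm_of_nonneg hr'.le]
    simp
  simp only [h1]
  rw [integral_mul_const, sphereCos]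
  have h2 : ∀ ω : Metric.sphere (0 : EuclideanSpace ℝ (Fin N)) 1,
      inner ℝ (s • e) (r • ω.1) = r * s * inner ℝ e ω.1 := fun ω => by
    rw [real_inner_smul_left, real_inner_smul_right]
    ring
  simp_rw [h2]
  have h3 : r ^ (β - 1) = r ^ (N - 1) * r ^ (β - N) := by
    rw [← Real.rpow_natCast, ← Real.rpow_add hr']
    congr 1
    push_cast [hN]
    ring
  rw [h3]
  ring

end Sphere

/-! ### Exponents of positivity -/

/-- Positivity of the solution for those exponents `β = N - a` for which the weight obtained by
integrating by parts is decreasing. -/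
lemma profileIntegral_pos {N : ℕ} (hN : 1 ≤ N) {β : ℝ} (hβ : β ∈ Set.Ioo (0 : ℝ) N) {a c : ℝ}
    (ha : a = N - β) (hc : c = ((N : ℝ) - 1) / 2) (hac : c < a + 1)
    (hP : ∀ X : ℝ, 0 ≤ X → a * (c - a - 1) + 4 * (c - 2 * a + 3) * X - 16 * X ^ 2 ≤ 0)
    (x : EuclideanSpace ℝ (Fin N)) : 0 < profileIntegral N β x := by
  have hN' : Nontrivial (EuclideanSpace ℝ (Fin N)) :=
    Module.nontrivial_of_finrank_pos (R := ℝ) (by simpa using Nat.pos_of_ne_zero (by omega))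
  have hN1 : (1 : ℝ) ≤ N := by exact_mod_cast hN
  by_cases hx : x = 0
  · subst hx
    have hI := integrable_exp_mul_norm_rpow hN ⟨hβ.1, hβ.2.le⟩
    simp only [profileIntegral, inner_zero_left, Real.cos_zero, one_mul]
    rw [integral_pos_iff_support_of_nonneg (fun ξ => by positivity) hI]
    have hsub : ({0}ᶜ : Set (EuclideanSpace ℝ (Fin N))) ⊆ Function.support
        fun ξ : EuclideanSpace ℝ (Fin N) => Real.exp (-‖ξ‖ ^ 4) * ‖ξ‖ ^ (β - N) := by
      intro ξ hξ
      have : 0 < ‖ξ‖ := norm_pos_iff.2 hξ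
      exact (by positivity : Real.exp (-‖ξ‖ ^ 4) * ‖ξ‖ ^ (β - N) ≠ 0)
    refine lt_of_lt_of_le ?_ (measure_mono hsub)
    exact isOpen_compl_singleton.measure_pos _ (Set.nonempty_compl_of_nontrivial 0)
  · have hs : 0 < ‖x‖ := norm_pos_iff.2 hx
    have he : ‖‖x‖⁻¹ • x‖ = 1 := by
      rw [norm_smul, norm_inv, norm_norm, inv_mul_cancel₀ hs.ne']
    have h := (isSphericalPair_sphereCos_sphereSin he).integral_pos (a := a) (by linarith)
      (by linarith [hβ.2]) (by linarith [hβ.1]) (by rwa [hc] at hac) (by rwa [hc] at hP) hs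
    have h2 := profileIntegral_smul_eq hN hβ (‖x‖⁻¹ • x) ‖x‖
    rw [smul_inv_smul₀ hs.ne'] at h2
    rw [h2]
    convert h using 6
    rw [ha]
    ring

/-- An explicit range of exponents of positivity: up to `(N + 1) / 2` for `N ≥ 3`, up to `1` for
`N = 2` and up to `7 / 16` for `N = 1`. -/
lemma exists_forall_profileIntegral_pos_of_le {N : ℕ} (hN : 1 ≤ N) :
    ∃ β₀ ∈ Set.Ioo (0 : ℝ) N, (3 ≤ N → β₀ = ((N : ℝ) + 1) / 2) ∧ (N = 2 → β₀ = 1) ∧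
      (N = 1 → β₀ = 7 / 16) ∧ ∀ β ∈ Set.Ioc (0 : ℝ) β₀, ∀ x, 0 < profileIntegral N β x := by
  -- the quadratic decreases in `a`, so only the largest exponent matters
  have key : ∀ β₀ ∈ Set.Ioo (0 : ℝ) N, β₀ ≤ (N + 1) / 2 ∨ N = 1 →
      (∀ X : ℝ, 0 ≤ X → (N - β₀) * (((N : ℝ) - 1) / 2 - (N - β₀) - 1) +
        4 * (((N : ℝ) - 1) / 2 - 2 * (N - β₀) + 3) * X - 16 * X ^ 2 ≤ 0) →
      ∀ β ∈ Set.Ioc (0 : ℝ) β₀, ∀ x, 0 < profileIntegral N β x := by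
    intro β₀ hβ₀ hle hP β hβ x
    have hc : ((N : ℝ) - 1) / 2 ≤ N - β₀ := by
      rcases hle with h | h
      · linarith
      · have := hβ₀.2
        subst h
        push_cast at *
        linarith
    refine profileIntegral_pos hN ⟨hβ.1, hβ.2.trans_lt hβ₀.2⟩ rfl rfl (by linarith [hβ.2]) ?_ x
    intro X hX
    have h1 := hP X hX
    have h2 : 0 ≤ (β₀ - β) * ((N - β) + (N - β₀) - (((N : ℝ) - 1) / 2 - 1) + 8 * X) :=
      mul_nonneg (by linarith [hβ.2]) (by linarith [hβ.2, hβ₀.2])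
    linarith
  rcases Nat.lt_or_ge N 3 with h3 | h3
  · interval_cases N
    · have hm : (7 / 16 : ℝ) ∈ Set.Ioo (0 : ℝ) (1 : ℕ) := by norm_num
      refine ⟨7 / 16, hm, by norm_num, by norm_num, by norm_num,
        key _ hm (Or.inr rfl) fun X hX => ?_⟩
      push_cast
      -- minus the quadratic is the perfect square `(4 X - 15 / 16) ^ 2`: the value `7 / 16` is sharp
      -- for this argument
      nlinarith [sq_nonneg (4 * X - 15 / 16)]
    · have hm : (1 : ℝ) ∈ Set.Ioo (0 : ℝ) (2 : ℕ) := by norm_num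
      refine ⟨1, hm, by norm_num, by norm_num, by norm_num,
        key _ hm (Or.inl (by norm_num)) fun X hX => ?_⟩
      push_cast
      nlinarith [sq_nonneg (4 * X - 3 / 4)]
  · have h3' : (3 : ℝ) ≤ N := by exact_mod_cast h3
    have hm : ((N : ℝ) + 1) / 2 ∈ Set.Ioo (0 : ℝ) N := ⟨by linarith, by linarith⟩
    refine ⟨(N + 1) / 2, hm, fun _ => rfl, fun h => by omega, fun h => by omega,
      key _ hm (Or.inl le_rfl) fun X hX => ?_⟩
    have hc : (1 : ℝ) ≤ ((N : ℝ) - 1) / 2 := by linarith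
    have hca : (N : ℝ) - (N + 1) / 2 = ((N : ℝ) - 1) / 2 := by ring
    rw [hca]
    nlinarith [sq_nonneg (4 * X - 1), mul_nonneg (sub_nonneg.2 hc) hX]

/-! ### Scaling to time one, and the three assertions -/

theorem theorem1p2 (N : ℕ) (hN : 1 ≤ N) :
    -- the integrals defining `S(t)φ` converge absolutely
    (∀ β ∈ Set.Ioo (0 : ℝ) N, ∀ (x : EuclideanSpace ℝ (Fin N)) (t : ℝ), 0 < t →
      Integrable (fun y => biharmonicHeatKernel N (x - y) t * powerDatum N β y)) ∧
    -- (i)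
    (∃ β₁ ∈ Set.Ioo (0 : ℝ) N, ∃ β₂ ∈ Set.Ioo (0 : ℝ) N,
      β₁ ≤ β₂ ∧
      (3 ≤ N → ((N : ℝ) + 1) / 2 < β₁) ∧
      (N = 2 → (1 : ℝ) / 2 < β₁) ∧
      (N = 1 → (7 : ℝ) / 16 < β₁) ∧
      (∀ β ∈ Set.Ioo (0 : ℝ) β₁, ∀ (x : EuclideanSpace ℝ (Fin N)) (t : ℝ), 0 < t →
        0 < biharmonicHeatSemigroup N t (powerDatum N β) x) ∧
      (∀ β ∈ Set.Ioo β₂ (N : ℝ), ∃ (x : EuclideanSpace ℝ (Fin N)) (t : ℝ), 0 < t ∧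
        biharmonicHeatSemigroup N t (powerDatum N β) x < 0)) ∧
    -- (ii)
    (∀ β ∈ Set.Ioo (0 : ℝ) N,
      (∀ (x : EuclideanSpace ℝ (Fin N)) (t : ℝ), 0 < t →
        0 < biharmonicHeatSemigroup N t (powerDatum N β) x) →
      ∃ K : ℝ, 0 < K ∧ ∀ (x : EuclideanSpace ℝ (Fin N)) (t : ℝ), 0 < t →
        K / (‖x‖ ^ β + t ^ (β / 4)) ≤ biharmonicHeatSemigroup N t (powerDatum N β) x) ∧
    -- (iii)
    (∀ β ∈ Set.Ioo (0 : ℝ) N,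
      ∃ K : ℝ, 0 < K ∧ ∀ (x : EuclideanSpace ℝ (Fin N)) (t : ℝ), 0 < t →
        |biharmonicHeatSemigroup N t (powerDatum N β) x| ≤ K / (‖x‖ ^ β + t ^ (β / 4))) := by
  -- with `t = l ^ 4` and `x = l • y` everything reduces to `t = 1`
  have hscale : ∀ (x : EuclideanSpace ℝ (Fin N)) (t : ℝ), 0 < t →
      ∃ l : ℝ, 0 < l ∧ t = l ^ 4 ∧ ∃ y, x = l • y := by
    intro x t ht
    have hl : 0 < t ^ ((4 : ℕ) : ℝ)⁻¹ := Real.rpow_pos_of_pos ht _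
    exact ⟨_, hl, (Real.rpow_inv_natCast_pow ht.le (by norm_num)).symm, _,
      (smul_inv_smul₀ hl.ne' x).symm⟩
  have hden : ∀ (K β l : ℝ) (y : EuclideanSpace ℝ (Fin N)), 0 < l →
      K / (‖l • y‖ ^ β + (l ^ 4) ^ (β / 4)) = l ^ (-β) * (K / (‖y‖ ^ β + 1)) := by
    intro K β l y hl
    have h1 : (l ^ 4) ^ (β / 4) = l ^ β := by
      rw [← Real.rpow_natCast, ← Real.rpow_mul hl.le]
      congr 1
      push_cast
      ring
    rw [h1, norm_smul, Real.norm_of_nonneg hl.le, Real.mul_rpow hl.le (norm_nonneg _),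
      Real.rpow_neg hl.le]
    have h2 : 0 < l ^ β := Real.rpow_pos_of_pos hl _
    have h3 : 0 ≤ ‖y‖ ^ β := by positivity
    field_simp
  refine ⟨?_, ?_, ?_, ?_⟩
  · intro β hβ x t ht
    obtain ⟨l, hl, rfl, y, rfl⟩ := hscale x t ht
    exact integrable_kernel_mul_powerDatum_scaled hN hβ hl y
  · obtain ⟨β₀, hβ₀, h3, h2, h1, hpos⟩ := exists_forall_profileIntegral_pos_of_le hN
    obtain ⟨β₁, hβ₁, hpos'⟩ := exists_forall_profileIntegral_pos hN hβ₀
      (hpos β₀ ⟨hβ₀.1, le_rfl⟩)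
    obtain ⟨β₂, hβ₂, x₀, hneg⟩ := exists_profileIntegral_neg hN
    refine ⟨β₁, ⟨hβ₀.1.trans hβ₁.1, hβ₁.2⟩, max β₁ β₂, ⟨lt_max_of_lt_right hβ₂.1,
      max_lt hβ₁.2 hβ₂.2⟩, le_max_left _ _, fun h => h3 h ▸ hβ₁.1, fun h => ?_,
      fun h => h1 h ▸ hβ₁.1, fun β hβ x t ht => ?_, fun β hβ => ?_⟩
    · have := h2 h ▸ hβ₁.1
      linarith
    · obtain ⟨l, hl, rfl, y, rfl⟩ := hscale x t ht
      obtain ⟨C, hC0, hC⟩ := exists_semigroup_eq_mul_profileIntegral hN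
        ⟨hβ.1, hβ.2.trans hβ₁.2⟩
      rw [semigroup_scaling N hl, hC]
      refine mul_pos (Real.rpow_pos_of_pos hl _) (mul_pos hC0 ?_)
      rcases le_or_gt β β₀ with h | h
      · exact hpos β ⟨hβ.1, h⟩ y
      · exact hpos' β ⟨h.le, hβ.2.le⟩ y
    · have hβ2 : β₂ < β := (le_max_right _ _).trans_lt hβ.1
      obtain ⟨C, hC0, hC⟩ := exists_semigroup_eq_mul_profileIntegral hN
        ⟨hβ₂.1.trans hβ2, hβ.2⟩
      refine ⟨x₀, 1, one_pos, ?_⟩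
      rw [hC]
      exact mul_neg_of_pos_of_neg hC0 (hneg β ⟨hβ2, hβ.2⟩)
  · intro β hβ hpos
    obtain ⟨K, hK0, hK⟩ := exists_le_semigroup_one hN hβ fun x => hpos x 1 one_pos
    refine ⟨K, hK0, fun x t ht => ?_⟩
    obtain ⟨l, hl, rfl, y, rfl⟩ := hscale x t ht
    rw [semigroup_scaling N hl, hden K β l y hl]
    exact mul_le_mul_of_nonneg_left (hK y) (Real.rpow_pos_of_pos hl _).le
  · intro β hβ
    obtain ⟨K, hK0, hK⟩ := exists_abs_semigroup_one_le hN hβ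
    refine ⟨K, hK0, fun x t ht => ?_⟩
    obtain ⟨l, hl, rfl, y, rfl⟩ := hscale x t ht
    rw [semigroup_scaling N hl, hden K β l y hl, abs_mul, abs_of_pos (Real.rpow_pos_of_pos hl _)]
    exact mul_le_mul_of_nonneg_left (hK y) (Real.rpow_pos_of_pos hl _).le
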